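/- Let $n,k\ge 2$, $[k]=\{0,1,\dots,k-1\}$, and order words over $[k]$ lexicographically (a proper prefix of a word being smaller than the word). Let $\mathcal R$ be the rotation $\mathcal R(\sigma_0\sigma_1\cdots\sigma_{n-1})=\sigma_1\cdots\sigma_{n-1}\sigma_0$. A nonempty word is *primitive* if it differs from all its rotations $\mathcal R^i$ with $0<i<$ its length; a *Lyndon word* is a primitive word that is least among its rotations; an *expanded Lyndon word* is $L^m$ with $L$ Lyndon and $m\ge1$. For $v\in[k]^n$ let $\mathsf{head}(v)$ hold if $v=(k-1)^t w\sigma$ for some $t\ge 0$, some word $w$ and some $\sigma\in[k-1]$ (i.e. $\sigma\ne k-1$) such that $\mathcal R^t(v)=w\sigma(k-1)^t$ is an expanded Lyndon word. For $\sigma\in[k]$, $w\in[k]^{n-1}$, put $S=S(w)=\{\sigma''\in[k-1]:\mathsf{head}(w\sigma'')\}$ and $$\mathsf{next}(\sigma w)=\begin{cases} w(\sigma+1) & \text{if }\sigma\ne k-1\text{ and }\mathsf{head}(w\sigma),\\ w(\min S) & \text{if }\sigma=k-1\text{ and }S\neq\emptyset,\\ w\sigma&\text{otherwise.}\end{cases}$$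 A *CFL (Chen–Fox–Lyndon) factorization* of a word $x$ is $x=w_0w_1\cdots w_{m-1}$ with all $w_i$ Lyndon and $w_0\ge w_1\ge\cdots\ge w_{m-1}$. A *fractional-power decomposition* of $x$ is $x=u^mv$ with $u$ Lyndon, $m\ge1$, and $v$ a proper prefix of $u$. Algorithm 1, on input $\sigma w$: 1. if $\sigma<k-1$ and $\mathsf{head}(w\sigma)$, return $w(\sigma+1)$; 2. else if $\sigma w=(k-1)^n$, return $(k-1)^{n-1}0$; 3. else if $\sigma=k-1$ and $\mathsf{head}(w(k-2))$: write $w=(k-1)^tw'$ with $w'=\tau_0\tau_1\cdots$, $\tau_0\ne k-1$, let $w'=u^mv$ be the fractional-power decomposition of $w'$ and $\sigma'=\tau_{|v|}$; if $\mathsf{head}(w\sigma')$ return $w\sigma'$, else return $w(\sigma'+1)$; 4. else return $w\sigma$. In its implementation, CFL factorizations are computed by Duval's algorithm; $\mathsf{head}$ of a word is evaluated by computing the CFL factorization $w_0\cdots w_{m-1}$ of its rotation $\mathcal R^i$, where $i$ is the largest integer such that $(k-1)^i$ is a prefix of the word, and testing whether $w_0=w_{m-1}$; and in step 3, $u$ is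 the first factor of the CFL factorization of $w'$ and $|v|$ is the remainder of $|w'|$ modulo $|u|$. **Theorem.** For all $n,k\ge2$ and every input $\sigma w\in[k]^n$ ($\sigma\in[k]$, $w\in[k]^{n-1}$): (a) Algorithm 1 returns $\mathsf{next}(\sigma w)$, and nothing else. (b) For every $\rho\in[k-1]$, with $i$ the largest integer such that $(k-1)^i$ is a prefix of $w\rho$, the word $\mathcal R^i(w\rho)$ has a CFL factorization, and for every CFL factorization $w_0w_1\cdots w_{m-1}$ of it, $\mathsf{head}(w\rho)$ holds if and only if $w_0=w_{m-1}$. (c) If $\sigma=k-1$, $S\ne\emptyset$ and $\sigma w\ne(k-1)^n$, then $w=(k-1)^tw'$ with $w'$ as in step 3, $w'$ has a fractional-power decomposition $u^mv$, and $\min S\in\{\sigma',\sigma'+1\}$ for $\sigma'=\tau_{|v|}$. (d) Algorithm 1, implemented as above on a random-access machine on which every elementary operation (arithmetic operation, comparison, access to a register or array cell, branch) takes one unit of time, computes $\mathsf{next}(\sigma w)$ in $O(n)$ time and with $O(n)$ memory cells, each of which only ever holds natural numbers at most $n+k$; the constants in the $O(n)$ bounds are absolute (they do not depend on $k$). -/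

import Mathlib

namespace PreferMin

/-! ### Words

Letters are natural numbers, `[k] = {a | a < k}`, and words are lists of letters, compared in the
lexicographic order of `List ℕ` (in which a proper prefix of a word is smaller than the word).
The rotation operator is `R^i v = v.rotate i`. -/

/-- `v` is a nonempty word whose cyclic order is its length. -/
def IsPrimitive (v : List ℕ) : Prop :=
  v ≠ [] ∧ ∀ i, 0 < i → i < v.length → v.rotate i ≠ v

/-- A primitive word that is lexicographically least among its rotations. -/
def IsLyndon (v : List ℕ) : Prop :=
  IsPrimitive v ∧ ∀ i, v ≤ v.rotate i

/-- The power `u ^ m` of a word. -/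
def wordPow (u : List ℕ) (m : ℕ) : List ℕ := (List.replicate m u).flatten

/-- A (positive) power of a Lyndon word. -/
def IsExpandedLyndon (v : List ℕ) : Prop :=
  ∃ L m, IsLyndon L ∧ 1 ≤ m ∧ v = wordPow L m

/-- `v = (k-1)^t w σ` with `σ ∈ [k-1]`, and `R^t v = w σ (k-1)^t` is an expanded Lyndon word. -/
def Head (k : ℕ) (v : List ℕ) : Prop :=
  ∃ (t : ℕ) (w : List ℕ) (σ : ℕ), v = List.replicate t (k - 1) ++ w ++ [σ] ∧ σ < k - 1 ∧
    IsExpandedLyndon (v.rotate t)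

/-- The set `S = {σ' ∈ [k-1] : head(w σ')}`. -/
def headLetters (k : ℕ) (w : List ℕ) : Set ℕ := {σ' | σ' < k - 1 ∧ Head k (w ++ [σ'])}

open Classical in
/-- The shift rule `next` on `[k]^n` (the value at the empty word is irrelevant). -/
noncomputable def next (k : ℕ) : List ℕ → List ℕ
  | [] => []
  | σ :: w =>
    if σ ≠ k - 1 ∧ Head k (w ++ [σ]) then w ++ [σ + 1]
    else if σ = k - 1 ∧ (headLetters k w).Nonempty then w ++ [sInf (headLetters k w)]
    else w ++ [σ]

/-- `fs` is a Chen–Fox–Lyndon factorization of `x`: a nonincreasing sequence of Lyndon words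
whose concatenation is `x`. -/
def IsCFL (x : List ℕ) (fs : List (List ℕ)) : Prop :=
  fs.flatten = x ∧ (∀ f ∈ fs, IsLyndon f) ∧ fs.Pairwise (fun a b => b ≤ a)

/-- `x = u^m v` with `u` a Lyndon word, `m ≥ 1`, and `v` a proper prefix of `u`. -/
def IsFractionalPower (x u : List ℕ) (m : ℕ) (v : List ℕ) : Prop :=
  x = wordPow u m ++ v ∧ IsLyndon u ∧ 1 ≤ m ∧ v <+: u ∧ v ≠ u

/-! ### The algorithm, as pseudocode

`Returns k σ w r` says that the algorithm, on input `σ w`, can return `r`. There is one constructor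
for each `return` statement, whose hypotheses are the outcomes of the tests on the way to it. -/

inductive Returns (k σ : ℕ) (w : List ℕ) : List ℕ → Prop
  | incr :
      (σ < k - 1 ∧ Head k (w ++ [σ])) →
      Returns k σ w (w ++ [σ + 1])
  | allMax :
      ¬ (σ < k - 1 ∧ Head k (w ++ [σ])) →
      σ :: w = List.replicate (w.length + 1) (k - 1) →
      Returns k σ w (List.replicate w.length (k - 1) ++ [0])
  | minFirst (t : ℕ) (w' u : List ℕ) (m : ℕ) (v : List ℕ) (σ' : ℕ) :
      ¬ (σ < k - 1 ∧ Head k (w ++ [σ])) →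
      σ :: w ≠ List.replicate (w.length + 1) (k - 1) →
      (σ = k - 1 ∧ Head k (w ++ [k - 2])) →
      w = List.replicate t (k - 1) ++ w' → w'.head? ≠ some (k - 1) →
      IsFractionalPower w' u m v →
      w'[v.length]? = some σ' →
      Head k (w ++ [σ']) →
      Returns k σ w (w ++ [σ'])
  | minSecond (t : ℕ) (w' u : List ℕ) (m : ℕ) (v : List ℕ) (σ' : ℕ) :
      ¬ (σ < k - 1 ∧ Head k (w ++ [σ])) →
      σ :: w ≠ List.replicate (w.length + 1) (k - 1) →
      (σ = k - 1 ∧ Head k (w ++ [k - 2])) →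
      w = List.replicate t (k - 1) ++ w' → w'.head? ≠ some (k - 1) →
      IsFractionalPower w' u m v →
      w'[v.length]? = some σ' →
      ¬ Head k (w ++ [σ']) →
      Returns k σ w (w ++ [σ' + 1])
  | rot :
      ¬ (σ < k - 1 ∧ Head k (w ++ [σ])) →
      σ :: w ≠ List.replicate (w.length + 1) (k - 1) →
      ¬ (σ = k - 1 ∧ Head k (w ++ [k - 2])) →
      Returns k σ w (w ++ [σ])

/-! ### The machine model

A random-access machine with finitely many registers and finitely many arrays, each cell of which
holds a natural number, programmed by structured programs. Every elementary operation
(an arithmetic operation, a comparison, an access to a register or to an array cell, a branch)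
takes one unit of time. -/

/-- The registers. -/
inductive Reg
  | n | k | i | j | p | s | m | len | h | a | t | r | sig
  deriving DecidableEq

instance : Fintype Reg where
  elems := {.n, .k, .i, .j, .p, .s, .m, .len, .h, .a, .t, .r, .sig}
  complete := by intro v; cases v <;> decide

/-- The arrays: the input, the output, the word whose head predicate is tested, the word that is
factorized, and the end points of its factors. -/
inductive Arr
  | inp | out | buf | x | fac
  deriving DecidableEq

instance : Fintype Arr where
  elems := {.inp, .out, .buf, .x, .fac}
  complete := by intro b; cases b <;> decide

structure State where
  reg : Reg → ℕ
  arr : Arr → ℕ → ℕ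

def State.setReg (s : State) (v : Reg) (y : ℕ) : State :=
  { s with reg := Function.update s.reg v y }

def State.setArr (s : State) (b : Arr) (i y : ℕ) : State :=
  { s with arr := Function.update s.arr b (Function.update (s.arr b) i y) }

inductive Expr
  | lit (c : ℕ)
  | reg (v : Reg)
  | read (b : Arr) (e : Expr)
  | plus (e f : Expr)
  | minus (e f : Expr)

namespace Expr

def eval (s : State) : Expr → ℕ
  | lit c => c
  | reg v => s.reg v
  | read b e => s.arr b (e.eval s)
  | plus e f => e.eval s + f.eval s
  | minus e f => e.eval s - f.eval s

/-- Every array access in the evaluation is to an address below `M`. -/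
def inBounds (M : ℕ) (s : State) : Expr → Prop
  | lit _ => True
  | reg _ => True
  | read _ e => e.inBounds M s ∧ e.eval s < M
  | plus e f => e.inBounds M s ∧ f.inBounds M s
  | minus e f => e.inBounds M s ∧ f.inBounds M s

def cost : Expr → ℕ
  | lit _ => 1
  | reg _ => 1
  | read _ e => e.cost + 1
  | plus e f => e.cost + f.cost + 1
  | minus e f => e.cost + f.cost + 1

end Expr

inductive Test
  | lt (e f : Expr)
  | le (e f : Expr)
  | eq (e f : Expr)
  | and (b c : Test)

namespace Test

def holds (s : State) : Test → Prop
  | lt e f => e.eval s < f.eval s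
  | le e f => e.eval s ≤ f.eval s
  | eq e f => e.eval s = f.eval s
  | and b c => b.holds s ∧ c.holds s

/-- Every array access in the evaluation is to an address below `M`; the second conjunct of a
conjunction is evaluated only if the first one holds. -/
def inBounds (M : ℕ) (s : State) : Test → Prop
  | lt e f => e.inBounds M s ∧ f.inBounds M s
  | le e f => e.inBounds M s ∧ f.inBounds M s
  | eq e f => e.inBounds M s ∧ f.inBounds M s
  | and b c => b.inBounds M s ∧ (b.holds s → c.inBounds M s)

def cost : Test → ℕ
  | lt e f => e.cost + f.cost + 1
  | le e f => e.cost + f.cost + 1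
  | eq e f => e.cost + f.cost + 1
  | and b c => b.cost + c.cost + 1

end Test

inductive Prog
  | skip
  | assign (v : Reg) (e : Expr)
  | store (b : Arr) (e f : Expr)
  | seq (c d : Prog)
  | cond (b : Test) (c d : Prog)
  | loop (b : Test) (c : Prog)

/-- Sequential composition of a list of programs. -/
def block : List Prog → Prog
  | [] => .skip
  | c :: l => .seq c (block l)

/-- `Exec M W c s s' T`: with arrays of `M` cells and with cells that can hold the numbers up to
`W`, the program `c` started in the state `s` terminates in the state `s'` after `T` units of time.
An access to an array cell outside of the available memory, or an attempt to write a number larger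
than `W`, blocks the execution. -/
inductive Exec (M W : ℕ) : Prog → State → State → ℕ → Prop
  | skip (s : State) : Exec M W .skip s s 1
  | assign (v : Reg) (e : Expr) (s : State) :
      e.inBounds M s → e.eval s ≤ W →
      Exec M W (.assign v e) s (s.setReg v (e.eval s)) (1 + e.cost)
  | store (b : Arr) (e f : Expr) (s : State) :
      e.inBounds M s → f.inBounds M s → e.eval s < M → f.eval s ≤ W →
      Exec M W (.store b e f) s (s.setArr b (e.eval s) (f.eval s)) (1 + e.cost + f.cost)
  | seq (c d : Prog) (s s' s'' : State) (T T' : ℕ) :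
      Exec M W c s s' T → Exec M W d s' s'' T' → Exec M W (.seq c d) s s'' (T + T')
  | condTrue (b : Test) (c d : Prog) (s s' : State) (T : ℕ) :
      b.inBounds M s → b.holds s → Exec M W c s s' T →
      Exec M W (.cond b c d) s s' (1 + b.cost + T)
  | condFalse (b : Test) (c d : Prog) (s s' : State) (T : ℕ) :
      b.inBounds M s → ¬ b.holds s → Exec M W d s s' T →
      Exec M W (.cond b c d) s s' (1 + b.cost + T)
  | loopFalse (b : Test) (c : Prog) (s : State) :
      b.inBounds M s → ¬ b.holds s →
      Exec M W (.loop b c) s s (1 + b.cost)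
  | loopTrue (b : Test) (c : Prog) (s s' s'' : State) (T T' : ℕ) :
      b.inBounds M s → b.holds s → Exec M W c s s' T → Exec M W (.loop b c) s' s'' T' →
      Exec M W (.loop b c) s s'' (1 + b.cost + T + T')

/-- The machine is deterministic. -/
theorem Exec.deterministic {M W : ℕ} {c : Prog} {s s₁ s₂ : State} {T₁ T₂ : ℕ}
    (h₁ : Exec M W c s s₁ T₁) (h₂ : Exec M W c s s₂ T₂) : s₁ = s₂ ∧ T₁ = T₂ := by
  induction h₁ generalizing s₂ T₂ with
  | skip s => cases h₂; exact ⟨rfl, rfl⟩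
  | assign => cases h₂; exact ⟨rfl, rfl⟩
  | store => cases h₂; exact ⟨rfl, rfl⟩
  | seq _ _ _ _ _ _ _ _ _ ih ih' =>
    cases h₂ with
    | seq _ _ _ _ _ _ _ g g' =>
      obtain ⟨rfl, rfl⟩ := ih g
      obtain ⟨rfl, rfl⟩ := ih' g'
      exact ⟨rfl, rfl⟩
  | condTrue _ _ _ _ _ _ _ hb _ ih =>
    cases h₂ with
    | condTrue _ _ _ _ _ _ _ _ g => obtain ⟨rfl, rfl⟩ := ih g; exact ⟨rfl, rfl⟩
    | condFalse _ _ _ _ _ _ _ hb' _ => exact absurd hb hb'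
  | condFalse _ _ _ _ _ _ _ hb _ ih =>
    cases h₂ with
    | condTrue _ _ _ _ _ _ _ hb' _ => exact absurd hb' hb
    | condFalse _ _ _ _ _ _ _ _ g => obtain ⟨rfl, rfl⟩ := ih g; exact ⟨rfl, rfl⟩
  | loopFalse _ _ _ _ hb =>
    cases h₂ with
    | loopFalse => exact ⟨rfl, rfl⟩
    | loopTrue _ _ _ _ _ _ _ _ hb' _ _ => exact absurd hb' hb
  | loopTrue _ _ _ _ _ _ _ _ hb _ _ ih ih' =>
    cases h₂ with
    | loopFalse _ _ _ _ hb' => exact absurd hb hb'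
    | loopTrue _ _ _ _ _ _ _ _ _ g g' =>
      obtain ⟨rfl, rfl⟩ := ih g
      obtain ⟨rfl, rfl⟩ := ih' g'
      exact ⟨rfl, rfl⟩

/-- The number of memory cells of a machine whose arrays have `M` cells each. -/
def memoryCells (M : ℕ) : ℕ := Fintype.card Reg + Fintype.card Arr * M

/-- At the start, `n` and `k` are in their registers, the input word is in the array `inp`,
and all other cells are zero. -/
def initState (n k : ℕ) (l : List ℕ) : State where
  reg := fun v => match v with
    | .n => n
    | .k => k
    | _ => 0
  arr := fun b i => match b with
    | .inp => l.getD i 0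
    | _ => 0

/-- The result is the word in the first `n` cells of the array `out`. -/
def output (n : ℕ) (s : State) : List ℕ := (List.range n).map (s.arr .out)

/-! ### The algorithm, as a program -/

/-- The letter `k - 1`. -/
def maxLetter : Expr := .minus (.reg .k) (.lit 1)

/-- `v := v + 1` -/
def incr (v : Reg) : Prog := .assign v (.plus (.reg v) (.lit 1))

/-- Write the word `w e` into the array `b`, where `σ w` is the input and `e` is a letter. -/
def writeShift (b : Arr) (e : Expr) : Prog := block [
  .assign .j (.lit 0),
  .loop (.lt (.plus (.reg .j) (.lit 1)) (.reg .n)) (block [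
    .store b (.reg .j) (.read .inp (.plus (.reg .j) (.lit 1))),
    incr .j]),
  .store b (.minus (.reg .n) (.lit 1)) e]

/-- Duval's algorithm: compute the Chen–Fox–Lyndon factorization `w₀ w₁ ⋯ w_{m-1}` of the word in
the first `len` cells of `x`. The factor `w_q` occupies the positions from `fac[q]` up to, but not
including, `fac[q+1]`. -/
def duval : Prog := block [
  .assign .m (.lit 0),
  .store .fac (.lit 0) (.lit 0),
  .assign .s (.lit 0),
  .loop (.lt (.reg .s) (.reg .len)) (block [
    .assign .j (.plus (.reg .s) (.lit 1)),
    .assign .p (.reg .s),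
    .loop (.and (.lt (.reg .j) (.reg .len))
        (.le (.read .x (.reg .p)) (.read .x (.reg .j)))) (block [
      .cond (.lt (.read .x (.reg .p)) (.read .x (.reg .j)))
        (.assign .p (.reg .s))
        (incr .p),
      incr .j]),
    .loop (.le (.reg .s) (.reg .p)) (block [
      .assign .s (.plus (.reg .s) (.minus (.reg .j) (.reg .p))),
      incr .m,
      .store .fac (.reg .m) (.reg .s)])])]

/-- Evaluate the head predicate on the word of length `n` in `buf`; the answer (`1` or `0`) is put
into the register `h`. With `i` the largest integer such that `(k-1)^i` is a prefix of the word,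
compute the factorization `w₀ w₁ ⋯ w_{m-1}` of its `i`-th rotation, and test whether
`w₀ = w_{m-1}`. -/
def headTest : Prog := block [
  .assign .i (.lit 0),
  .loop (.and (.lt (.reg .i) (.reg .n)) (.eq (.read .buf (.reg .i)) maxLetter)) (incr .i),
  .assign .j (.lit 0),
  .loop (.lt (.reg .j) (.reg .n)) (block [
    .cond (.lt (.plus (.reg .i) (.reg .j)) (.reg .n))
      (.store .x (.reg .j) (.read .buf (.plus (.reg .i) (.reg .j))))
      (.store .x (.reg .j) (.read .buf (.minus (.plus (.reg .i) (.reg .j)) (.reg .n)))),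
    incr .j]),
  .assign .len (.reg .n),
  duval,
  .cond (.eq (.read .fac (.lit 1))
      (.minus (.reg .n) (.read .fac (.minus (.reg .m) (.lit 1)))))
    (block [
      .assign .h (.lit 1),
      .assign .j (.lit 0),
      .loop (.lt (.reg .j) (.read .fac (.lit 1))) (block [
        .cond (.eq (.read .x (.reg .j))
            (.read .x (.plus (.read .fac (.minus (.reg .m) (.lit 1))) (.reg .j))))
          .skip
          (.assign .h (.lit 0)),
        incr .j])])
    (.assign .h (.lit 0))]

/-- The letter `σ` of the input `σ w`. -/
def firstLetter : Expr := .read .inp (.lit 0)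

/-- Put into the register `sig` the letter `σ' = τ_{|v|}`, where `w = (k-1)^t w'`,
`w' = τ₀ τ₁ ⋯` does not start with `k-1`, and `w' = u^m v` is the fractional-power decomposition:
`u` is the first factor of the Chen–Fox–Lyndon factorization of `w'`, and `|v|` is what remains of
`|w'|` after removing `|u|` as often as possible. -/
def findLetter : Prog := block [
  .assign .t (.lit 0),
  .loop (.and (.lt (.plus (.reg .t) (.lit 1)) (.reg .n))
      (.eq (.read .inp (.plus (.reg .t) (.lit 1))) maxLetter)) (incr .t),
  .assign .len (.minus (.minus (.reg .n) (.lit 1)) (.reg .t)),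
  .assign .j (.lit 0),
  .loop (.lt (.reg .j) (.reg .len)) (block [
    .store .x (.reg .j) (.read .inp (.plus (.plus (.reg .t) (.lit 1)) (.reg .j))),
    incr .j]),
  duval,
  .assign .r (.reg .len),
  .loop (.le (.read .fac (.lit 1)) (.reg .r))
    (.assign .r (.minus (.reg .r) (.read .fac (.lit 1)))),
  .assign .sig (.read .x (.reg .r))]

/-- The whole algorithm, on the input `σ w`. -/
def algorithm : Prog := block [
  -- `h := (σ < k-1 ∧ head(w σ))`
  .assign .h (.lit 0),
  .cond (.lt firstLetter maxLetter)
    (block [writeShift .buf firstLetter, headTest])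
    .skip,
  .cond (.eq (.reg .h) (.lit 1))
    (writeShift .out (.plus firstLetter (.lit 1)))
    (block [
      -- `a := (σ w = (k-1)^n)`
      .assign .a (.lit 1),
      .assign .j (.lit 0),
      .loop (.lt (.reg .j) (.reg .n)) (block [
        .cond (.eq (.read .inp (.reg .j)) maxLetter) .skip (.assign .a (.lit 0)),
        incr .j]),
      .cond (.eq (.reg .a) (.lit 1))
        -- here `w = (k-1)^(n-1)`
        (writeShift .out (.lit 0))
        (block [
          -- `h := (σ = k-1 ∧ head(w (k-2)))`
          .assign .h (.lit 0),
          .cond (.eq firstLetter maxLetter)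
            (block [writeShift .buf (.minus (.reg .k) (.lit 2)), headTest])
            .skip,
          .cond (.eq (.reg .h) (.lit 1))
            (block [
              findLetter,
              writeShift .buf (.reg .sig),
              headTest,
              .cond (.eq (.reg .h) (.lit 1))
                (writeShift .out (.reg .sig))
                (writeShift .out (.plus (.reg .sig) (.lit 1)))])
            (writeShift .out firstLetter)])])]

end PreferMin

/-! Write w = (k-1)^t w', where w' does not begin with k-1. An expanded Lyndon word begins with its
least letter, so the rotation exponent in the head predicate must be the maximal one
(`head_iff_isExpandedLyndon_rotate`), and head(wρ) says that w'ρ(k-1)^t is an expanded Lyndon word.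
If some ρ achieves this, then no suffix of w' falls below the prefix of the same length, and such a
prenecklace is a fractional power u^m v of a Lyndon word (`Prenecklace.exists_lyndonPeriod`).

Let σ' = τ_{|v|}, the letter that continues the period. Duval's lemma decides every other letter. If
ρ < σ', the word drops below its own prefix and head fails (`not_head_of_lt`). If ρ > σ', then w'ρ
is Lyndon and stays so when letters k-1, all larger than its first letter, are appended
(`head_of_lt`). Only ρ = σ' remains open. So a nonempty S is an upper set of [k-1] with minimum σ'
or σ'+1 (`isLeast_headLetters`), and testing k-2 detects whether it is nonempty
(`headLetters_nonempty_iff`). If w' is empty, every letter of [k-1] is in S and the minimum is 0.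

The head test rests on `IsCFL.isExpandedLyndon_iff`. In a power of a Lyndon word u, a Lyndon prefix
has length at most |u|, whereas a Lyndon suffix that is also a prefix has length at least |u|; so
the first and last factors coincide. Conversely, if they coincide, monotonicity makes all factors
equal.

For the machine, `runs_loop` combines an invariant with a potential that pays for time. Each round
of Duval's algorithm scans a maximal fractional power and cuts off all its whole periods. What is
left is shorter than one period, so more than half of the scanned letters are consumed, and the
rescanning is paid for (`runs_duval`). On a prenecklace the first scan reaches the end of the word,
so the first factor is the u of the fractional power (`DuvalStop.lyndonPeriod`). -/

namespace PreferMin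

/-! ### Words as functions

A word of length `N` is given by the first `N` values of a function `f : ℕ → ℕ`. -/

/-- The word is smaller than each of its proper suffixes, and not because of a prefix relation. -/
def LyndonFn (f : ℕ → ℕ) (N : ℕ) : Prop :=
  0 < N ∧ ∀ i, 0 < i → i < N → ∃ d, i + d < N ∧ (∀ e < d, f e = f (i + e)) ∧ f d < f (i + d)

/-- The word is a fractional power of a Lyndon word of length `q`. -/
def LyndonPeriod (f : ℕ → ℕ) (N q : ℕ) : Prop :=
  q ≤ N ∧ LyndonFn f q ∧ ∀ i < N, f i = f (i % q)

/-- No suffix of the word is smaller than the prefix of the same length. -/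
def Prenecklace (f : ℕ → ℕ) (N : ℕ) : Prop :=
  ∀ i d, i + d < N → (∀ e < d, f e = f (i + e)) → f d ≤ f (i + d)

theorem LyndonFn.congr {f g : ℕ → ℕ} {N : ℕ} (h : LyndonFn f N) (hfg : ∀ i < N, f i = g i) :
    LyndonFn g N := by
  refine ⟨h.1, fun i hi hiN => ?_⟩
  obtain ⟨d, hd, he, hlt⟩ := h.2 i hi hiN
  refine ⟨d, hd, fun e hed => ?_, ?_⟩
  · rw [← hfg e (by omega), ← hfg (i + e) (by omega), he e hed]
  · rwa [← hfg d (by omega), ← hfg (i + d) (by omega)]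

theorem LyndonPeriod.congr {f g : ℕ → ℕ} {N q : ℕ} (h : LyndonPeriod f N q)
    (hfg : ∀ i < N, f i = g i) : LyndonPeriod g N q := by
  obtain ⟨h1, h2, h3⟩ := h
  have := h2.1
  refine ⟨h1, h2.congr fun i hi => hfg i (by omega), fun i hi => ?_⟩
  rw [← hfg i hi, h3 i hi, hfg]
  have := Nat.mod_lt i this
  omega

theorem Prenecklace.mono {f : ℕ → ℕ} {N N' : ℕ} (h : Prenecklace f N) (hN : N' ≤ N) :
    Prenecklace f N' := fun i d hid he => h i d (by omega) he

theorem Prenecklace.congr {f g : ℕ → ℕ} {N : ℕ} (h : Prenecklace f N)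
    (hfg : ∀ i < N, f i = g i) : Prenecklace g N := by
  intro i d hid he
  rw [← hfg d (by omega), ← hfg (i + d) (by omega)]
  refine h i d hid fun e hed => ?_
  rw [hfg e (by omega), hfg (i + e) (by omega), he e hed]

theorem LyndonFn.lyndonPeriod {f : ℕ → ℕ} {N : ℕ} (h : LyndonFn f N) : LyndonPeriod f N N :=
  ⟨le_rfl, h, fun i hi => by rw [Nat.mod_eq_of_lt hi]⟩

theorem lyndonFn_one (f : ℕ → ℕ) : LyndonFn f 1 :=
  ⟨one_pos, fun i hi hi' => by omega⟩

theorem LyndonPeriod.pos {f : ℕ → ℕ} {N q : ℕ} (h : LyndonPeriod f N q) : 0 < q := h.2.1.1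

/-- Links the two descriptions of the periodic continuation: Duval's algorithm compares the next
letter with position N - q, whereas σ' is read at position N % q. -/
theorem LyndonPeriod.sub {f : ℕ → ℕ} {N q : ℕ} (h : LyndonPeriod f N q) :
    f (N - q) = f (N % q) := by
  have hq := h.pos
  have := h.1
  rw [h.2.2 (N - q) (by omega)]
  congr 1
  exact (Nat.mod_eq_sub_mod this).symm

theorem LyndonPeriod.add {f : ℕ → ℕ} {N q : ℕ} (h : LyndonPeriod f N q) {i : ℕ} (hi : q + i < N) :
    f (q + i) = f i := by
  rw [h.2.2 _ hi, h.2.2 i (by omega), Nat.add_mod_left]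

/-- Duval's lemma, equal letter. -/
theorem LyndonPeriod.succ_of_eq {f : ℕ → ℕ} {N q : ℕ} (h : LyndonPeriod f N q)
    (heq : f N = f (N - q)) : LyndonPeriod f (N + 1) q := by
  refine ⟨h.1.trans (Nat.le_succ N), h.2.1, fun i hi => ?_⟩
  rcases Nat.lt_succ_iff_lt_or_eq.1 hi with hi | rfl
  · exact h.2.2 i hi
  · rw [heq, h.sub]

/-- Duval's lemma, larger letter. -/
theorem LyndonPeriod.lyndonFn_succ_of_lt {f : ℕ → ℕ} {N q : ℕ} (h : LyndonPeriod f N q)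
    (hlt : f (N - q) < f N) : LyndonFn f (N + 1) := by
  obtain ⟨hqN, hL, hper⟩ := h
  have hq := hL.1
  have hsub := LyndonPeriod.sub ⟨hqN, hL, hper⟩
  refine ⟨Nat.succ_pos N, fun i hi hiN => ?_⟩
  have hr := Nat.mod_lt i hq
  have hdm := Nat.div_add_mod i q
  have key : ∀ e, i % q + e < q → (i + e) % q = i % q + e := fun e he => by
    rw [← Nat.mod_eq_of_lt he, Nat.mod_add_mod]
  rcases Nat.eq_zero_or_pos (i % q) with h0 | hpos
  -- The suffix starts at a period boundary, so it repeats the prefix until the last letter, which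
  -- is larger than the periodic continuation.
  · have hmod : ∀ e, (i + e) % q = e % q := fun e => by rw [Nat.add_mod, h0, zero_add, Nat.mod_mod]
    refine ⟨N - i, by omega, fun e he => ?_, ?_⟩
    · rw [hper e (by omega), hper (i + e) (by omega), hmod]
    · rw [hper (N - i) (by omega), ← hmod, show i + (N - i) = N by omega, ← hsub]
      exact hlt
  · obtain ⟨d, hd, he, hlt'⟩ := hL.2 (i % q) hpos hr
    by_cases hN : i + d < N
    · refine ⟨d, by omega, fun e hed => ?_, ?_⟩
      · rw [hper (i + e) (by omega), key e (by omega), he e hed]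
      · rw [hper (i + d) (by omega), key d (by omega)]
        exact hlt'
    -- The word ends before the mismatch inside u is passed. Up to that point u is at most its own
    -- suffix, so f (N - i) is at most the periodic continuation, which is less than f N.
    · refine ⟨N - i, by omega, fun e hed => ?_, ?_⟩
      · rw [hper (i + e) (by omega), key e (by omega), he e (by omega)]
      · have h1 : f (N - i) ≤ f (i % q + (N - i)) := by
          rcases Nat.lt_or_ge (N - i) d with hlt'' | hge
          · exact (he _ hlt'').le
          · have : N - i = d := by omega
            rw [this]; exact hlt'.le
        rw [← key _ (by omega), show i + (N - i) = N by omega, ← hsub] at h1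
        rw [show i + (N - i) = N by omega]
        omega

/-- A Lyndon word is its own period, so the letter that would continue it periodically is its first
one; any larger letter falls under the strict case of Duval's lemma. -/
theorem LyndonFn.extend {f : ℕ → ℕ} {a N : ℕ} (h : LyndonFn f a) (haN : a ≤ N)
    (hlt : ∀ i, a ≤ i → i < N → f 0 < f i) : LyndonFn f N := by
  induction N, haN using Nat.le_induction with
  | base => exact h
  | succ N haN ih =>
    have hN := ih fun i hi hi' => hlt i hi (by omega)
    refine hN.lyndonPeriod.lyndonFn_succ_of_lt ?_
    rw [Nat.sub_self]
    exact hlt N haN (by omega)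

/-- A power of a Lyndon word is a prenecklace. -/
theorem LyndonPeriod.prenecklace {f : ℕ → ℕ} {N q : ℕ} (h : LyndonPeriod f N q)
    (hdvd : q ∣ N) : Prenecklace f N := by
  obtain ⟨hqN, hL, hper⟩ := h
  have hq := hL.1
  intro i d hid he
  rcases Nat.eq_zero_or_pos (i % q) with h0 | hpos
  · rw [hper d (by omega), hper (i + d) hid, Nat.add_mod, h0, zero_add, Nat.mod_mod]
  · obtain ⟨d₀, hd₀, he₀, hlt₀⟩ := hL.2 (i % q) hpos (Nat.mod_lt i hq)
    have key : ∀ e, i % q + e < q → (i + e) % q = i % q + e := fun e he => by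
      rw [← Nat.mod_eq_of_lt he, Nat.mod_add_mod]
    -- Divisibility enters here: the copy of u that contains position i is complete, so the mismatch
    -- d₀ falls inside the word.
    have hlen : i + d₀ < N := by
      obtain ⟨c, rfl⟩ := hdvd
      have hdm := Nat.div_add_mod i q
      have : i / q < c := by
        apply Nat.div_lt_of_lt_mul; omega
      have : q * (i / q + 1) ≤ q * c := Nat.mul_le_mul_left q this
      rw [Nat.mul_add] at this
      omega
    have hlt : f d₀ < f (i + d₀) := by rw [hper (i + d₀) hlen, key _ hd₀]; exact hlt₀
    have heq : ∀ e < d₀, f e = f (i + e) := fun e hed => by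
      rw [hper (i + e) (by omega), key e (by omega), he₀ e hed]
    rcases lt_trichotomy d d₀ with hd | rfl | hd
    · exact (heq d hd).le
    · exact hlt.le
    · exact absurd (he d₀ hd) hlt.ne

/-- A prenecklace is a fractional power of a Lyndon word. -/
theorem Prenecklace.exists_lyndonPeriod {f : ℕ → ℕ} {N : ℕ} (h : Prenecklace f N) (hN : 0 < N) :
    ∃ q, LyndonPeriod f N q := by
  induction N, hN using Nat.le_induction with
  | base => exact ⟨1, (lyndonFn_one f).lyndonPeriod⟩
  | succ N hN ih =>
    obtain ⟨q, hq⟩ := ih (h.mono (Nat.le_succ N))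
    have := hq.1
    -- The suffix at q repeats the prefix up to the last letter, so the prenecklace condition
    -- excludes a smaller last letter. The two remaining cases are those of Duval's lemma.
    have hle : f (N - q) ≤ f N := by
      have := h q (N - q) (by omega) fun e he => (hq.add (by omega)).symm
      rwa [show q + (N - q) = N by omega] at this
    rcases hle.lt_or_eq with hlt | heq
    · exact ⟨N + 1, (hq.lyndonFn_succ_of_lt hlt).lyndonPeriod⟩
    · exact ⟨q, hq.succ_of_eq heq.symm⟩

/-- A Lyndon prefix of a fractional power of `u` is not longer than `u`. -/
theorem LyndonPeriod.le_of_lyndonFn {f : ℕ → ℕ} {N q a : ℕ} (h : LyndonPeriod f N q)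
    (ha : LyndonFn f a) (haN : a ≤ N) : a ≤ q := by
  by_contra hlt
  obtain ⟨d, hd, -, hdlt⟩ := ha.2 q h.pos (by omega)
  rw [h.add (by omega)] at hdlt
  exact lt_irrefl _ hdlt

/-- In a power of a Lyndon word, a Lyndon prefix `u` and a Lyndon suffix `v ≤ u` coincide. -/
theorem LyndonPeriod.suffix_eq_prefix {f : ℕ → ℕ} {N q a b : ℕ} (h : LyndonPeriod f N q)
    (hdvd : q ∣ N) (ha : LyndonFn f a) (haN : a ≤ N) (hb : LyndonFn (fun i => f (N - b + i)) b)
    (hbN : b ≤ N)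
    (hle : (∃ d, d < a ∧ d < b ∧ (∀ e < d, f (N - b + e) = f e) ∧ f (N - b + d) < f d) ∨
      (b ≤ a ∧ ∀ e < b, f (N - b + e) = f e)) :
    a = b ∧ ∀ e < b, f (N - b + e) = f e := by
  have hpre := h.prenecklace hdvd
  rcases hle with ⟨d, hda, hdb, he, hlt⟩ | ⟨hba, he⟩
  · have := hpre (N - b) d (by omega) fun e hed => (he e hed).symm
    omega
  · refine ⟨?_, he⟩
    have haq := h.le_of_lyndonFn ha haN
    have hqN := h.1
    have hb0 := hb.1
    suffices hqb : q ≤ b by omega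
    -- If b < q, the suffix of length b is a proper suffix of the last copy of u. Since u is Lyndon,
    -- that suffix differs from the prefix of u within its length, against `he`.
    by_contra hbq
    obtain ⟨c, rfl⟩ := hdvd
    have hc : 0 < c := Nat.pos_of_ne_zero fun h0 => by subst h0; omega
    obtain ⟨c, rfl⟩ : ∃ c', c = c' + 1 := ⟨c - 1, by omega⟩
    rw [Nat.mul_add, Nat.mul_one] at *
    obtain ⟨d, hd, -, hlt⟩ := h.2.1.2 (q - b) (by omega) (by omega)
    have h1 := he d (by omega)
    rw [h.2.2 _ (by omega), show q * c + q - b + d = q - b + d + q * c by omega,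
      Nat.add_mul_mod_self_left, Nat.mod_eq_of_lt (by omega)] at h1
    omega

/-! ### From lists to functions -/

/-- The letter of `l` at position `i`. -/
def letter (l : List ℕ) (i : ℕ) : ℕ := l.getD i 0

theorem letter_eq_getElem {l : List ℕ} {i : ℕ} (h : i < l.length) : letter l i = l[i] := by
  simp [letter, h]

theorem ext_letter {l l' : List ℕ} (hlen : l.length = l'.length)
    (h : ∀ i < l.length, letter l i = letter l' i) : l = l' :=
  List.ext_getElem hlen fun i hi hi' => by
    rw [← letter_eq_getElem hi, ← letter_eq_getElem hi', h i hi]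

theorem letter_append_left {l l' : List ℕ} {i : ℕ} (h : i < l.length) :
    letter (l ++ l') i = letter l i := by
  simp [letter, List.getElem?_append_left h]

theorem letter_append_right {l l' : List ℕ} (i : ℕ) :
    letter (l ++ l') (l.length + i) = letter l' i := by
  simp [letter, List.getElem?_append_right]

theorem letter_replicate {n a i : ℕ} (h : i < n) : letter (List.replicate n a) i = a := by
  simp [letter, h]

theorem letter_rotate {l : List ℕ} {i j : ℕ} (h : j < l.length) :
    letter (l.rotate i) j = letter l ((j + i) % l.length) := by
  rw [letter_eq_getElem (by simpa using h), List.getElem_rotate,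
    letter_eq_getElem (Nat.mod_lt _ (by omega))]

theorem letter_map_range (f : ℕ → ℕ) {N i : ℕ} (h : i < N) :
    letter ((List.range N).map f) i = f i := by
  rw [letter_eq_getElem (by simpa using h)]; simp

theorem letter_lt {l : List ℕ} {K i : ℕ} (h : ∀ a ∈ l, a < K) (hi : i < l.length) :
    letter l i < K := by
  rw [letter_eq_getElem hi]; exact h _ (List.getElem_mem hi)

/-- Splits the order into a strict first mismatch and a prefix relation; `LyndonFn` rules out the
latter, and `LyndonPeriod.suffix_eq_prefix` takes its hypothesis in this form. -/
theorem le_iff_letter {l l' : List ℕ} :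
    l ≤ l' ↔ (∃ d, d < l'.length ∧ d < l.length ∧ (∀ e < d, letter l e = letter l' e) ∧
        letter l d < letter l' d) ∨
      (l.length ≤ l'.length ∧ ∀ e < l.length, letter l e = letter l' e) := by
  have := List.le_iff_exists (l₁ := l) (l₂ := l')
  refine not_lt.symm.trans (this.trans ?_)
  rw [or_comm]
  refine or_congr ⟨?_, ?_⟩ ⟨?_, ?_⟩
  · rintro ⟨i, h₁, h₂, he, hlt⟩
    refine ⟨i, h₂, h₁, fun e hei => ?_, ?_⟩
    · rw [letter_eq_getElem (by omega), letter_eq_getElem (by omega)]; exact he e hei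
    · rwa [letter_eq_getElem h₁, letter_eq_getElem h₂]
  · rintro ⟨i, h₂, h₁, he, hlt⟩
    refine ⟨i, h₁, h₂, fun e hei => ?_, ?_⟩
    · rw [← letter_eq_getElem, ← letter_eq_getElem]; exact he e hei
    · rwa [← letter_eq_getElem h₁, ← letter_eq_getElem h₂]
  · intro h
    have hp : l <+: l' := List.prefix_iff_eq_take.2 h
    refine ⟨hp.length_le, fun e he => ?_⟩
    obtain ⟨t, rfl⟩ := hp
    rw [letter_append_left he]
  · rintro ⟨hlen, h⟩
    refine ext_letter (by simpa using hlen) fun i hi => ?_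
    rw [h i hi, letter_eq_getElem (by omega), letter_eq_getElem (by simp; omega)]
    simp

/-- Passes from rotations to suffixes. A mismatch inside a suffix is also one with the rotation that
starts there. Conversely, if a rotation first differs after wrapping around, the suffix is a border,
and the complementary rotation turns out to be smaller than the word. -/
theorem isLyndon_iff {l : List ℕ} : IsLyndon l ↔ LyndonFn (letter l) l.length := by
  constructor
  · rintro ⟨⟨hne, hprim⟩, hle⟩
    refine ⟨List.length_pos_iff.2 hne, fun i hi hiN => ?_⟩
    have hneq := hprim i hi hiN
    rcases le_iff_letter.1 (hle i) with ⟨d, hd, -, he, hlt⟩ | ⟨-, he⟩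
    · rw [List.length_rotate] at hd
      have hrot : ∀ e < l.length - i, letter (l.rotate i) e = letter l (i + e) := fun e hei => by
        rw [letter_rotate (by omega), Nat.mod_eq_of_lt (by omega), add_comm]
      by_cases hN : i + d < l.length
      · refine ⟨d, hN, fun e hed => ?_, ?_⟩
        · rw [← hrot e (by omega)]; exact he e hed
        · rw [← hrot d (by omega)]; exact hlt
      -- The mismatch lies at `d'` letters past the wrap, and there the rotation by `l.length - i`
      -- is smaller than `l`, which contradicts minimality.
      · exfalso
        have hwrap : ∀ e < i, letter (l.rotate i) (l.length - i + e) = letter l e := fun e hei => by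
          rw [letter_rotate (by omega), show l.length - i + e + i = e + l.length by omega,
            Nat.add_mod_right, Nat.mod_eq_of_lt (by omega)]
        have hrot' : ∀ e < i, letter (l.rotate (l.length - i)) e = letter l (l.length - i + e) :=
          fun e hei => by
            rw [letter_rotate (by omega), Nat.mod_eq_of_lt (by omega), add_comm]
        obtain ⟨d', rfl⟩ : ∃ d', d = l.length - i + d' := ⟨d - (l.length - i), by omega⟩
        rw [hwrap _ (by omega)] at hlt
        have heq : ∀ e < d', letter l (l.length - i + e) = letter l e := fun e hed => by
          rw [he _ (by omega), hwrap _ (by omega)]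
        rcases le_iff_letter.1 (hle (l.length - i)) with ⟨d, hd2, -, he2, hlt2⟩ | ⟨-, he2⟩
        · rcases lt_trichotomy d d' with h | h | h
          · rw [hrot' _ (by omega), heq d h] at hlt2; exact lt_irrefl _ hlt2
          · subst h; rw [hrot' _ (by omega)] at hlt2; omega
          · have := he2 d' h
            rw [hrot' _ (by omega)] at this; omega
        · have := he2 d' (by omega)
          rw [hrot' _ (by omega)] at this; omega
    · exact absurd (ext_letter (by simp) he).symm hneq
  · rintro ⟨hpos, h⟩
    have hne : l ≠ [] := List.length_pos_iff.1 hpos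
    have key : ∀ i, 0 < i → i < l.length → ∃ d < l.length,
        (∀ e < d, letter l e = letter (l.rotate i) e) ∧ letter l d < letter (l.rotate i) d := by
      intro i hi hiN
      obtain ⟨d, hd, he, hlt⟩ := h i hi hiN
      have hrot : ∀ e < l.length - i, letter (l.rotate i) e = letter l (i + e) := fun e hei => by
        rw [letter_rotate (by omega), Nat.mod_eq_of_lt (by omega), add_comm]
      refine ⟨d, by omega, fun e hed => ?_, ?_⟩
      · rw [hrot _ (by omega), he e hed]
      · rwa [hrot _ (by omega)]
    refine ⟨⟨hne, fun i hi hiN heq => ?_⟩, fun i => ?_⟩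
    · obtain ⟨d, -, -, hlt⟩ := key i hi hiN
      rw [heq] at hlt; exact lt_irrefl _ hlt
    · rw [← List.rotate_mod]
      rcases Nat.eq_zero_or_pos (i % l.length) with h0 | h0
      · rw [h0, List.rotate_zero]
      · obtain ⟨d, hd, he, hlt⟩ := key _ h0 (Nat.mod_lt _ hpos)
        exact le_iff_letter.2 (Or.inl ⟨d, by simpa using hd, hd, he, hlt⟩)

/-! ### Powers and fractional powers of words as periodicity of letters -/

theorem length_wordPow (u : List ℕ) (m : ℕ) : (wordPow u m).length = m * u.length := by
  simp [wordPow]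

theorem letter_wordPow_append {u v : List ℕ} (hv : v <+: u) {m i : ℕ}
    (hi : i < m * u.length + v.length) : letter (wordPow u m ++ v) i = letter u (i % u.length) := by
  have hvu := hv.length_le
  induction m generalizing i with
  | zero =>
    obtain ⟨r, rfl⟩ := hv
    rw [Nat.zero_mul, Nat.zero_add] at hi
    rw [Nat.mod_eq_of_lt (by omega), letter_append_left hi]
    simp [wordPow]
  | succ m ih =>
    have hs : wordPow u (m + 1) = u ++ wordPow u m := by
      simp [wordPow, List.replicate_succ]
    rw [hs, List.append_assoc]
    rcases Nat.lt_or_ge i u.length with h | h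
    · rw [letter_append_left h, Nat.mod_eq_of_lt h]
    · obtain ⟨j, rfl⟩ := Nat.exists_eq_add_of_le h
      rw [letter_append_right, Nat.add_mod_left, ih]
      rw [Nat.add_mul] at hi
      omega

theorem eq_wordPow_append_iff {x u v : List ℕ} {m : ℕ} (hv : v <+: u) :
    x = wordPow u m ++ v ↔ x.length = m * u.length + v.length ∧
      ∀ i < x.length, letter x i = letter u (i % u.length) := by
  constructor
  · rintro rfl
    have hl : (wordPow u m ++ v).length = m * u.length + v.length := by
      rw [List.length_append, length_wordPow]
    exact ⟨hl, fun i hi => letter_wordPow_append hv (hl ▸ hi)⟩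
  · rintro ⟨hl, h⟩
    refine ext_letter (by rw [List.length_append, length_wordPow, hl]) fun i hi => ?_
    rw [h i hi, letter_wordPow_append hv (hl ▸ hi)]

theorem letter_take {l : List ℕ} {q i : ℕ} (h : i < q) : letter (l.take q) i = letter l i := by
  simp [letter, h]

theorem isLyndon_take_iff {l : List ℕ} {q : ℕ} (h : q ≤ l.length) :
    IsLyndon (l.take q) ↔ LyndonFn (letter l) q := by
  rw [isLyndon_iff, List.length_take_of_le h]
  exact ⟨fun hl => hl.congr fun i hi => letter_take hi,
    fun hl => hl.congr fun i hi => (letter_take hi).symm⟩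

theorem lyndonPeriod_of_eq {x u v : List ℕ} {m : ℕ} (hx : x = wordPow u m ++ v) (hu : IsLyndon u)
    (hm : 1 ≤ m) (hv : v <+: u) : LyndonPeriod (letter x) x.length u.length := by
  have hu' := isLyndon_iff.1 hu
  obtain ⟨hl, h⟩ := (eq_wordPow_append_iff hv).1 hx
  have hle : u.length ≤ x.length := by
    have := Nat.le_mul_of_pos_left u.length hm
    omega
  have heq : ∀ i < u.length, letter x i = letter u i := fun i hi => by
    rw [h i (by omega), Nat.mod_eq_of_lt hi]
  exact ⟨hle, hu'.congr fun i hi => (heq i hi).symm, fun i hi => by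
    rw [h i hi, heq _ (Nat.mod_lt _ hu'.1)]⟩

theorem IsFractionalPower.lyndonPeriod {x u v : List ℕ} {m : ℕ} (h : IsFractionalPower x u m v) :
    LyndonPeriod (letter x) x.length u.length ∧ v.length = x.length % u.length := by
  obtain ⟨hx, hu, hm, hv, hvu⟩ := h
  refine ⟨lyndonPeriod_of_eq hx hu hm hv, ?_⟩
  have hlt : v.length < u.length :=
    lt_of_le_of_ne hv.length_le fun he => hvu (hv.eq_of_length he)
  rw [((eq_wordPow_append_iff hv).1 hx).1, mul_comm, Nat.mul_add_mod, Nat.mod_eq_of_lt hlt]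

/-- The period alone determines the decomposition: u and v are the prefixes of lengths q and |x| mod
q. -/
theorem LyndonPeriod.isFractionalPower {x : List ℕ} {q : ℕ}
    (h : LyndonPeriod (letter x) x.length q) :
    IsFractionalPower x (x.take q) (x.length / q) (x.take (x.length % q)) := by
  have hq := h.pos
  have hr := Nat.mod_lt x.length hq
  have hlen : (x.take q).length = q := List.length_take_of_le h.1
  have hlen' : (x.take (x.length % q)).length = x.length % q :=
    List.length_take_of_le (by have := h.1; omega)
  have hpre : x.take (x.length % q) <+: x.take q := List.take_prefix_take_left hr.le
  refine ⟨(eq_wordPow_append_iff hpre).2 ⟨?_, fun i hi => ?_⟩, (isLyndon_take_iff h.1).2 h.2.1,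
    Nat.div_pos h.1 hq, hpre, fun he => ?_⟩
  · rw [hlen, hlen', Nat.div_add_mod']
  · rw [hlen, letter_take (Nat.mod_lt _ hq)]
    exact h.2.2 i hi
  · have := congrArg List.length he
    omega

theorem isExpandedLyndon_iff {x : List ℕ} :
    IsExpandedLyndon x ↔ ∃ q, LyndonPeriod (letter x) x.length q ∧ q ∣ x.length := by
  constructor
  · rintro ⟨L, m, hL, hm, hx⟩
    rw [← List.append_nil (wordPow L m)] at hx
    refine ⟨L.length, lyndonPeriod_of_eq hx hL hm List.nil_prefix, ?_⟩
    rw [((eq_wordPow_append_iff List.nil_prefix).1 hx).1]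
    simp
  · rintro ⟨q, h, hd⟩
    obtain ⟨h1, h2, h3, -, -⟩ := h.isFractionalPower
    rw [Nat.mod_eq_zero_of_dvd hd, List.take_zero, List.append_nil] at h1
    exact ⟨_, _, h2, h3, h1⟩

theorem IsExpandedLyndon.prenecklace {x : List ℕ} (h : IsExpandedLyndon x) :
    Prenecklace (letter x) x.length := by
  obtain ⟨q, hq, hd⟩ := isExpandedLyndon_iff.1 h
  exact hq.prenecklace hd

theorem IsExpandedLyndon.letter_zero_le {x : List ℕ} (h : IsExpandedLyndon x) {i : ℕ}
    (hi : i < x.length) : letter x 0 ≤ letter x i :=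
  h.prenecklace i 0 hi fun e he => absurd he (Nat.not_lt_zero e)

theorem LyndonFn.isExpandedLyndon {x : List ℕ} (h : LyndonFn (letter x) x.length) :
    IsExpandedLyndon x :=
  isExpandedLyndon_iff.2 ⟨_, h.lyndonPeriod, dvd_rfl⟩

/-! ### Chen–Fox–Lyndon factorizations -/

/-- A word is an expanded Lyndon word if and only if the first and the last factor of its
Chen–Fox–Lyndon factorization coincide. -/
theorem IsCFL.isExpandedLyndon_iff {x : List ℕ} {fs : List (List ℕ)} (h : IsCFL x fs)
    (hx : x ≠ []) : IsExpandedLyndon x ↔ fs.head? = fs.getLast? := by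
  obtain ⟨rfl, hlyn, hpw⟩ := h
  have hfs : fs ≠ [] := by rintro rfl; exact hx rfl
  constructor
  · intro hexp
    obtain ⟨q, hq, hd⟩ := PreferMin.isExpandedLyndon_iff.1 hexp
    set x := fs.flatten with hxdef
    set a := fs.head hfs with ha
    set b := fs.getLast hfs with hb
    have hla : IsLyndon a := hlyn _ (List.head_mem hfs)
    have hlb : IsLyndon b := hlyn _ (List.getLast_mem hfs)
    have hxa : x = a ++ fs.tail.flatten := by
      rw [hxdef]; conv_lhs => rw [← List.cons_head_tail hfs]
      rw [List.flatten_cons]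
    have hxb : x = fs.dropLast.flatten ++ b := by
      rw [hxdef]; conv_lhs => rw [← List.dropLast_append_getLast hfs]
      simp [hb]
    have hba : b ≤ a := by
      rw [ha, hb]
      obtain ⟨c, l, rfl⟩ := List.exists_cons_of_ne_nil hfs
      rcases List.eq_nil_or_concat l with rfl | ⟨l', d, rfl⟩
      · simp
      · simp only [List.concat_eq_append] at hpw ⊢
        simpa using (List.pairwise_cons.1 hpw).1 d (by simp)
    have hlenb : b.length ≤ x.length := by rw [hxb]; simp
    have hlena : a.length ≤ x.length := by rw [hxa]; simp
    have hta : ∀ i < a.length, letter x i = letter a i := fun i hi => by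
      rw [hxa, letter_append_left hi]
    have htb : ∀ i, letter x (x.length - b.length + i) = letter b i := fun i => by
      conv_lhs => rw [hxb]
      rw [List.length_append, Nat.add_sub_cancel, letter_append_right]
    have hres := hq.suffix_eq_prefix hd
      ((isLyndon_iff.1 hla).congr fun i hi => (hta i hi).symm) hlena
      ((isLyndon_iff.1 hlb).congr fun i hi => (htb i).symm) hlenb (by
        simp only [htb]
        rcases le_iff_letter.1 hba with ⟨d, h1, h2, h3, h4⟩ | ⟨h1, h2⟩
        · refine Or.inl ⟨d, h1, h2, fun e he => ?_, ?_⟩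
          · rw [h3 e he, hta e (by omega)]
          · rwa [hta d h1]
        · exact Or.inr ⟨h1, fun e he => by rw [h2 e he, hta e (by omega)]⟩)
    have hab : a = b := ext_letter hres.1 fun i hi => by
      rw [← hta i hi, ← htb, hres.2 i (hres.1 ▸ hi)]
    rw [List.head?_eq_some_head hfs, List.getLast?_eq_some_getLast hfs, ← ha, ← hb, hab]
  · intro heq
    rw [List.head?_eq_some_head hfs, List.getLast?_eq_some_getLast hfs, Option.some_inj] at heq
    refine ⟨fs.head hfs, fs.length, hlyn _ (List.head_mem hfs), List.length_pos_iff.2 hfs, ?_⟩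
    rw [wordPow]
    congr 1
    refine List.eq_replicate_iff.2 ⟨rfl, fun b hb => ?_⟩
    -- Every factor lies between the last and the first, so equality of these two makes all of them
    -- equal.
    have h1 : b ≤ fs.head hfs := by
      obtain ⟨c, l, rfl⟩ := List.exists_cons_of_ne_nil hfs
      rcases List.mem_cons.1 hb with rfl | hb
      · simp
      · exact (List.pairwise_cons.1 hpw).1 b hb
    have h2 : fs.getLast hfs ≤ b := by
      rw [← List.dropLast_append_getLast hfs] at hpw hb
      rcases List.mem_append.1 hb with hb | hb
      · exact (List.pairwise_append.1 hpw).2.2 b hb _ (List.mem_singleton_self _)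
      · rw [List.mem_singleton.1 hb]
    exact le_antisymm h1 (heq ▸ h2)

/-! ### The head predicate -/

/-- The definition of `Head` allows any t for which (k-1)^t is a prefix. A smaller t than the
maximal one would leave k-1 as the first letter of the rotation, although the rotation contains ρ <
k-1. -/
theorem head_iff_isExpandedLyndon_rotate {k ρ i : ℕ} {w : List ℕ} (hρ : ρ < k - 1)
    (hi : IsGreatest {i : ℕ | List.replicate i (k - 1) <+: w ++ [ρ]} i) :
    Head k (w ++ [ρ]) ↔ IsExpandedLyndon ((w ++ [ρ]).rotate i) := by
  have hpre : List.replicate i (k - 1) <+: w ++ [ρ] := hi.1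
  have hletter : ∀ j < i, letter (w ++ [ρ]) j = k - 1 := fun j hj => by
    obtain ⟨r, hr⟩ := hpre
    rw [← hr, letter_append_left (by simpa using hj), letter_replicate hj]
  have hlast : letter (w ++ [ρ]) w.length = ρ := by
    simp [letter]
  have hiw : i ≤ w.length := by
    by_contra hlt
    have := hletter w.length (by omega)
    omega
  constructor
  · rintro ⟨t, w₁, σ, heq, hσ, hexp⟩
    have ht : t ≤ i := hi.2 ⟨w₁ ++ [σ], by rw [heq, List.append_assoc]⟩
    rcases ht.lt_or_eq with hlt | rfl
    · exfalso
      have hlen : (w ++ [ρ]).length = w.length + 1 := by simp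
      have h1 := hexp.letter_zero_le (i := w.length - t) (by simp)
      rw [letter_rotate (by omega), letter_rotate (by omega), hlen, Nat.mod_eq_of_lt (by omega),
        Nat.mod_eq_of_lt (by omega), show w.length - t + t = w.length by omega, zero_add,
        hletter t hlt, hlast] at h1
      omega
    · exact hexp
  · intro hexp
    have hpre' : List.replicate i (k - 1) <+: w :=
      List.prefix_of_prefix_length_le hpre (List.prefix_append w [ρ]) (by simpa using hiw)
    obtain ⟨w₁, hw₁⟩ := hpre'
    exact ⟨i, w₁, ρ, by rw [hw₁], hρ, hexp⟩

theorem isGreatest_replicate_prefix {t K : ℕ} {l : List ℕ} (hl : l ≠ []) (h : l.head? ≠ some K) :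
    IsGreatest {i : ℕ | List.replicate i K <+: List.replicate t K ++ l} t := by
  refine ⟨List.prefix_append _ _, fun i hi => ?_⟩
  by_contra hlt
  obtain ⟨r, hr⟩ := hi
  obtain ⟨a, l, rfl⟩ := List.exists_cons_of_ne_nil hl
  have h1 := congrArg (letter · t) hr
  rw [letter_append_left (by simp; omega), letter_replicate (by omega)] at h1
  have h2 := letter_append_right (l := List.replicate t K) (l' := a :: l) 0
  rw [List.length_replicate, Nat.add_zero, ← h1] at h2
  exact h (by rw [List.head?_cons, h2]; simp [letter])

theorem head_replicate_append_iff {k t ρ : ℕ} {w' : List ℕ} (hρ : ρ < k - 1)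
    (h : w'.head? ≠ some (k - 1)) :
    Head k (List.replicate t (k - 1) ++ w' ++ [ρ]) ↔
      IsExpandedLyndon (w' ++ [ρ] ++ List.replicate t (k - 1)) := by
  have hne : (w' ++ [ρ]).head? ≠ some (k - 1) := by
    cases w' with
    | nil => simpa using hρ.ne
    | cons a l => simpa using h
  rw [head_iff_isExpandedLyndon_rotate (i := t) hρ
    (by rw [List.append_assoc]; exact isGreatest_replicate_prefix (by simp) hne),
    List.append_assoc]
  have := List.rotate_append_length_eq (List.replicate t (k - 1)) (w' ++ [ρ])
  rw [List.length_replicate] at this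
  rw [this]

/-! ### Which letters belong to S -/

section
variable {k t ρ : ℕ} {w' : List ℕ}

theorem lyndonPeriod_append {q : ℕ} (hq : LyndonPeriod (letter w') w'.length q) (r : List ℕ) :
    LyndonPeriod (letter (w' ++ r)) w'.length q :=
  hq.congr fun _ hi => (letter_append_left hi).symm

theorem letter_append_length (a : ℕ) (r : List ℕ) : letter (w' ++ a :: r) w'.length = a := by
  simp [letter]

/-- The suffix of w'ρ that starts after one period copies the prefix until ρ, where it becomes
smaller; an expanded Lyndon word has no such suffix. -/
theorem not_head_of_lt (hρ : ρ < k - 1) (h : w'.head? ≠ some (k - 1)) {q : ℕ}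
    (hq : LyndonPeriod (letter w') w'.length q) (hlt : ρ < letter w' (w'.length % q)) :
    ¬ Head k (List.replicate t (k - 1) ++ w' ++ [ρ]) := by
  rw [head_replicate_append_iff hρ h, List.append_assoc, List.singleton_append]
  intro hexp
  have hq' := lyndonPeriod_append hq (ρ :: List.replicate t (k - 1))
  have hle := hq.1
  have hp := hq.pos
  have := hexp.prenecklace q (w'.length - q) (by simp; omega)
    fun e he => (hq'.add (by omega)).symm
  rw [show q + (w'.length - q) = w'.length by omega, letter_append_length, hq'.sub,
    letter_append_left ((Nat.mod_lt _ hp).trans_le hle)] at this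
  omega

/-- By Duval's lemma w'ρ is Lyndon. Its first letter is that of w', which is below k-1, so the
trailing block of letters k-1 can be appended by `LyndonFn.extend`. -/
theorem head_of_lt (hρ : ρ < k - 1) (h : w'.head? ≠ some (k - 1)) (hk : ∀ a ∈ w', a < k) {q : ℕ}
    (hq : LyndonPeriod (letter w') w'.length q) (hlt : letter w' (w'.length % q) < ρ) :
    Head k (List.replicate t (k - 1) ++ w' ++ [ρ]) := by
  rw [head_replicate_append_iff hρ h, List.append_assoc, List.singleton_append]
  have hq' := lyndonPeriod_append hq (ρ :: List.replicate t (k - 1))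
  have hle := hq.1
  have hp := hq.pos
  have h1 : LyndonFn (letter (w' ++ ρ :: List.replicate t (k - 1))) (w'.length + 1) := by
    refine hq'.lyndonFn_succ_of_lt ?_
    rwa [hq'.sub, letter_append_left ((Nat.mod_lt _ hp).trans_le hle), letter_append_length]
  refine (h1.extend (by simp) fun i hi hi' => ?_).isExpandedLyndon
  have h0 : letter w' 0 < k - 1 := by
    obtain ⟨a, l, rfl⟩ := List.exists_cons_of_ne_nil (List.length_pos_iff.1 (hp.trans_le hle))
    have := hk a (by simp)
    have : a ≠ k - 1 := by simpa using h
    simp [letter]; omega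
  rw [letter_append_left (by omega)]
  obtain ⟨j, rfl⟩ := Nat.exists_eq_add_of_le hi
  have := letter_append_right (l := w' ++ [ρ]) (l' := List.replicate t (k - 1)) j
  rw [List.length_append, List.length_singleton, List.append_assoc, List.singleton_append] at this
  rw [this, letter_replicate (by simp at hi'; omega)]
  exact h0

theorem head_replicate_append_singleton (hρ : ρ < k - 1) :
    Head k (List.replicate t (k - 1) ++ [ρ]) := by
  have := head_replicate_append_iff (t := t) (w' := []) hρ (by simp)
  rw [List.append_nil] at this
  rw [this, List.nil_append, List.singleton_append]
  refine ((lyndonFn_one _).extend (by simp) fun i hi hi' => ?_).isExpandedLyndon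
  obtain ⟨j, rfl⟩ := Nat.exists_eq_add_of_le hi
  have := letter_append_right (l := [ρ]) (l' := List.replicate t (k - 1)) j
  rw [List.length_singleton, List.singleton_append] at this
  rw [this, letter_replicate (by simp at hi'; omega)]
  exact hρ

/-- The prenecklace property passes to prefixes, so a single successful letter already gives w' a
fractional-power decomposition. -/
theorem Head.prenecklace (hρ : ρ < k - 1) (h : w'.head? ≠ some (k - 1))
    (hh : Head k (List.replicate t (k - 1) ++ w' ++ [ρ])) :
    Prenecklace (letter w') w'.length := by
  rw [head_replicate_append_iff hρ h, List.append_assoc] at hh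
  exact (hh.prenecklace.mono (by simp)).congr fun i hi => letter_append_left hi

theorem exists_eq_replicate_append (K : ℕ) (w : List ℕ) :
    ∃ t w', w = List.replicate t K ++ w' ∧ w'.head? ≠ some K := by
  induction w with
  | nil => exact ⟨0, [], by simp, by simp⟩
  | cons a w ih =>
    by_cases ha : a = K
    · obtain ⟨t, w', rfl, h⟩ := ih
      exact ⟨t + 1, w', by rw [ha, List.replicate_succ, List.cons_append], h⟩
    · exact ⟨0, a :: w, by simp, by simpa using ha⟩

/-- The shape of the set `S`: it is an upper set of `[k-1]` that has `σ'` or `σ' + 1` as its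
minimum. -/
theorem isLeast_headLetters (h : w'.head? ≠ some (k - 1)) (hk : ∀ a ∈ w', a < k) {q : ℕ}
    (hq : LyndonPeriod (letter w') w'.length q)
    (hne : (headLetters k (List.replicate t (k - 1) ++ w')).Nonempty) :
    (Head k (List.replicate t (k - 1) ++ w' ++ [letter w' (w'.length % q)]) →
      IsLeast (headLetters k (List.replicate t (k - 1) ++ w')) (letter w' (w'.length % q))) ∧
    (¬ Head k (List.replicate t (k - 1) ++ w' ++ [letter w' (w'.length % q)]) →
      IsLeast (headLetters k (List.replicate t (k - 1) ++ w')) (letter w' (w'.length % q) + 1)) := by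
  set c := letter w' (w'.length % q) with hc
  have hlow : ∀ ρ ∈ headLetters k (List.replicate t (k - 1) ++ w'), c ≤ ρ := fun ρ hρ => by
    by_contra hlt
    exact not_head_of_lt hρ.1 h hq (by omega) hρ.2
  obtain ⟨ρ, hρ⟩ := hne
  have hcρ := hlow ρ hρ
  have hρk := hρ.1
  refine ⟨fun hh => ⟨⟨by omega, hh⟩, hlow⟩, fun hh => ?_⟩
  have hlow' : ∀ ρ ∈ headLetters k (List.replicate t (k - 1) ++ w'), c + 1 ≤ ρ := fun ρ hρ => by
    have := hlow ρ hρ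
    rcases this.lt_or_eq with h1 | h1
    · exact h1
    · exact absurd (h1 ▸ hρ.2) hh
  -- An element of S above σ' is needed: it gives σ' + 1 ≤ ρ < k - 1, so that σ' + 1 is still a
  -- letter of [k-1].
  have := hlow' ρ hρ
  exact ⟨⟨by omega, head_of_lt (by omega) h hk hq (by omega)⟩, hlow'⟩

/-- This is why one test in step 3 suffices: a member of S is at least σ', so if it is not k-2
itself, then k-2 exceeds σ'. -/
theorem headLetters_nonempty_iff (hk2 : 2 ≤ k) (hw' : w' ≠ []) (h : w'.head? ≠ some (k - 1))
    (hk : ∀ a ∈ w', a < k) :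
    (headLetters k (List.replicate t (k - 1) ++ w')).Nonempty ↔
      Head k (List.replicate t (k - 1) ++ w' ++ [k - 2]) := by
  refine ⟨fun ⟨ρ, hρ⟩ => ?_, fun hh => ⟨k - 2, by omega, hh⟩⟩
  have hρk := hρ.1
  obtain ⟨q, hq⟩ := (Head.prenecklace hρ.1 h hρ.2).exists_lyndonPeriod (List.length_pos_iff.2 hw')
  by_cases heq : ρ = k - 2
  · exact heq ▸ hρ.2
  · have : letter w' (w'.length % q) ≤ ρ := by
      by_contra hlt
      exact not_head_of_lt hρ.1 h hq (by omega) hρ.2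
    exact head_of_lt (by omega) h hk hq (by omega)

end

/-! ### Reasoning about executions -/

/-- The registers that a program may write to. -/
def Prog.writesReg : Prog → Reg → Bool
  | .skip, _ => false
  | .assign v _, u => decide (u = v)
  | .store _ _ _, _ => false
  | .seq c d, u => c.writesReg u || d.writesReg u
  | .cond _ c d, u => c.writesReg u || d.writesReg u
  | .loop _ c, u => c.writesReg u

/-- The arrays that a program may write to. -/
def Prog.writesArr : Prog → Arr → Bool
  | .skip, _ => false
  | .assign _ _, _ => false
  | .store b _ _, u => decide (u = b)
  | .seq c d, u => c.writesArr u || d.writesArr u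
  | .cond _ c d, u => c.writesArr u || d.writesArr u
  | .loop _ c, u => c.writesArr u

/-- The states `s` and `s'` agree outside of the registers and arrays that `c` may write to. -/
def Frame (c : Prog) (s s' : State) : Prop :=
  (∀ v, c.writesReg v = false → s'.reg v = s.reg v) ∧
    ∀ b, c.writesArr b = false → s'.arr b = s.arr b

theorem Frame.refl (c : Prog) (s : State) : Frame c s s := ⟨fun _ _ => rfl, fun _ _ => rfl⟩

theorem Frame.trans {c : Prog} {s s' s'' : State} (h : Frame c s s') (h' : Frame c s' s'') :
    Frame c s s'' :=
  ⟨fun v hv => (h'.1 v hv).trans (h.1 v hv), fun b hb => (h'.2 b hb).trans (h.2 b hb)⟩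

theorem Frame.mono {c d : Prog} {s s' : State} (h : Frame c s s')
    (hr : ∀ v, d.writesReg v = false → c.writesReg v = false)
    (ha : ∀ b, d.writesArr b = false → c.writesArr b = false) : Frame d s s' :=
  ⟨fun v hv => h.1 v (hr v hv), fun b hb => h.2 b (ha b hb)⟩

@[simp] theorem State.setReg_reg (s : State) (v u : Reg) (y : ℕ) :
    (s.setReg v y).reg u = if u = v then y else s.reg u := by
  simp [State.setReg, Function.update_apply]

@[simp] theorem State.setReg_arr (s : State) (v : Reg) (y : ℕ) : (s.setReg v y).arr = s.arr := rfl

@[simp] theorem State.setArr_reg (s : State) (b : Arr) (i y : ℕ) :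
    (s.setArr b i y).reg = s.reg := rfl

@[simp] theorem State.setArr_arr (s : State) (b c : Arr) (i y : ℕ) :
    (s.setArr b i y).arr c = if c = b then Function.update (s.arr c) i y else s.arr c := by
  by_cases h : c = b
  · subst h; simp [State.setArr]
  · simp [State.setArr, h]

/-- Which cells a program leaves alone is decidable from its text, so loop invariants need to
mention only what the loop changes. -/
theorem Exec.frame {M W : ℕ} {c : Prog} {s s' : State} {T : ℕ} (h : Exec M W c s s' T) :
    Frame c s s' := by
  induction h with
  | skip => exact Frame.refl _ _
  | assign v e s =>
    refine ⟨fun u hu => ?_, fun _ _ => rfl⟩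
    have : u ≠ v := by simpa [Prog.writesReg] using hu
    simp [this]
  | store b e f s =>
    refine ⟨fun _ _ => rfl, fun u hu => ?_⟩
    have : u ≠ b := by simpa [Prog.writesArr] using hu
    simp [this]
  | seq c d s s' s'' T T' _ _ ih ih' =>
    refine Frame.trans (ih.mono ?_ ?_) (ih'.mono ?_ ?_) <;>
      simp +contextual [Prog.writesReg, Prog.writesArr]
  | condTrue _ _ _ _ _ _ _ _ _ ih =>
    refine ih.mono ?_ ?_ <;> simp +contextual [Prog.writesReg, Prog.writesArr]
  | condFalse _ _ _ _ _ _ _ _ _ ih =>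
    refine ih.mono ?_ ?_ <;> simp +contextual [Prog.writesReg, Prog.writesArr]
  | loopFalse => exact Frame.refl _ _
  | loopTrue _ _ _ _ _ _ _ _ _ _ _ ih ih' => exact Frame.trans ⟨ih.1, ih.2⟩ ih'

/-- The program terminates, in a state and after a time that satisfy `Q`. -/
def Runs (M W : ℕ) (c : Prog) (s : State) (Q : State → ℕ → Prop) : Prop :=
  ∃ s' T, Exec M W c s s' T ∧ Q s' T

section Rules
variable {M W : ℕ} {s : State} {Q Q' : State → ℕ → Prop}

theorem Runs.mono {c : Prog} (h : Runs M W c s Q)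
    (hQ : ∀ s' T, Frame c s s' → Q s' T → Q' s' T) : Runs M W c s Q' := by
  obtain ⟨s', T, he, hq⟩ := h
  exact ⟨s', T, he, hQ s' T he.frame hq⟩

theorem runs_skip : Runs M W .skip s Q ↔ Q s 1 :=
  ⟨fun ⟨_, _, h, hq⟩ => by cases h; exact hq, fun h => ⟨_, _, .skip s, h⟩⟩

theorem runs_assign {v : Reg} {e : Expr} : Runs M W (.assign v e) s Q ↔
    e.inBounds M s ∧ e.eval s ≤ W ∧ Q (s.setReg v (e.eval s)) (1 + e.cost) :=
  ⟨fun ⟨_, _, h, hq⟩ => by cases h with | assign _ _ _ h1 h2 => exact ⟨h1, h2, hq⟩,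
    fun h => ⟨_, _, .assign v e s h.1 h.2.1, h.2.2⟩⟩

theorem runs_store {b : Arr} {e f : Expr} : Runs M W (.store b e f) s Q ↔
    e.inBounds M s ∧ f.inBounds M s ∧ e.eval s < M ∧ f.eval s ≤ W ∧
      Q (s.setArr b (e.eval s) (f.eval s)) (1 + e.cost + f.cost) :=
  ⟨fun ⟨_, _, h, hq⟩ => by cases h with | store _ _ _ _ h1 h2 h3 h4 => exact ⟨h1, h2, h3, h4, hq⟩,
    fun h => ⟨_, _, .store b e f s h.1 h.2.1 h.2.2.1 h.2.2.2.1, h.2.2.2.2⟩⟩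

theorem runs_seq {c d : Prog} : Runs M W (.seq c d) s Q ↔
    Runs M W c s fun s' T => Runs M W d s' fun s'' T' => Q s'' (T + T') :=
  ⟨fun ⟨_, _, h, hq⟩ => by
    cases h with | seq _ _ _ _ _ _ _ h1 h2 => exact ⟨_, _, h1, _, _, h2, hq⟩,
    fun ⟨_, _, h1, _, _, h2, hq⟩ => ⟨_, _, .seq _ _ _ _ _ _ _ h1 h2, hq⟩⟩

theorem runs_cond {b : Test} {c d : Prog} : Runs M W (.cond b c d) s Q ↔
    b.inBounds M s ∧ (b.holds s → Runs M W c s fun s' T => Q s' (1 + b.cost + T)) ∧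
      (¬ b.holds s → Runs M W d s fun s' T => Q s' (1 + b.cost + T)) := by
  constructor
  · rintro ⟨_, _, h, hq⟩
    cases h with
    | condTrue _ _ _ _ _ _ h1 h2 h3 => exact ⟨h1, fun _ => ⟨_, _, h3, hq⟩, fun h => absurd h2 h⟩
    | condFalse _ _ _ _ _ _ h1 h2 h3 => exact ⟨h1, fun h => absurd h h2, fun _ => ⟨_, _, h3, hq⟩⟩
  · rintro ⟨h1, h2, h3⟩
    by_cases hb : b.holds s
    · obtain ⟨_, _, h, hq⟩ := h2 hb
      exact ⟨_, _, .condTrue _ _ _ _ _ _ h1 hb h, hq⟩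
    · obtain ⟨_, _, h, hq⟩ := h3 hb
      exact ⟨_, _, .condFalse _ _ _ _ _ _ h1 hb h, hq⟩

/-- The rule for loops, with an invariant `I` and a potential `μ` that pays for the running
time. -/
theorem runs_loop {b : Test} {c : Prog} (I : State → Prop) (μ : State → ℕ) (h0 : I s)
    (hb : ∀ s', Frame c s s' → I s' → b.inBounds M s')
    (hc : ∀ s', Frame c s s' → I s' → b.holds s' →
      Runs M W c s' fun s'' T => I s'' ∧ μ s'' + T + (1 + b.cost) ≤ μ s')
    (hQ : ∀ s' T, Frame c s s' → I s' → ¬ b.holds s' → μ s' + T ≤ μ s + (1 + b.cost) → Q s' T) :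
    Runs M W (.loop b c) s Q := by
  -- Induction on a bound for the potential. Every pass lowers it by at least the positive cost of
  -- the test, which yields termination along with the time bound; the last, failing test is the
  -- extra term.
  suffices H : ∀ N s₁, μ s₁ ≤ N → Frame c s s₁ → I s₁ → ∃ s' T, Exec M W (.loop b c) s₁ s' T ∧
      I s' ∧ ¬ b.holds s' ∧ μ s' + T ≤ μ s₁ + (1 + b.cost) by
    obtain ⟨s', T, he, h1, h2, h3⟩ := H (μ s) s le_rfl (Frame.refl _ _) h0
    exact ⟨s', T, he, hQ s' T he.frame h1 h2 h3⟩
  intro N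
  induction N with
  | zero =>
    intro s₁ hμ hf hI
    by_cases hh : b.holds s₁
    · obtain ⟨_, _, -, -, h⟩ := hc s₁ hf hI hh
      omega
    · exact ⟨s₁, _, .loopFalse _ _ _ (hb s₁ hf hI) hh, hI, hh, le_rfl⟩
  | succ N ih =>
    intro s₁ hμ hf hI
    by_cases hh : b.holds s₁
    · obtain ⟨s₂, T, he, hI₂, h⟩ := hc s₁ hf hI hh
      obtain ⟨s', T', he', h1, h2, h3⟩ := ih s₂ (by omega) (hf.trans he.frame) hI₂
      exact ⟨s', _, .loopTrue _ _ _ _ _ _ _ (hb s₁ hf hI) hh he he', h1, h2, by omega⟩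
    · exact ⟨s₁, _, .loopFalse _ _ _ (hb s₁ hf hI) hh, hI, hh, le_rfl⟩

end Rules

/-! ### Segments of an array -/

/-- The word in the cells `s, …, s + e - 1`. -/
def segment (f : ℕ → ℕ) (s e : ℕ) : List ℕ := (List.range e).map fun i => f (s + i)

@[simp] theorem length_segment (f : ℕ → ℕ) (s e : ℕ) : (segment f s e).length = e := by
  simp [segment]

theorem letter_segment {f : ℕ → ℕ} {s e i : ℕ} (h : i < e) : letter (segment f s e) i = f (s + i) :=
  letter_map_range _ h

theorem segment_add (f : ℕ → ℕ) (s e e' : ℕ) :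
    segment f s (e + e') = segment f s e ++ segment f (s + e) e' := by
  simp [segment, List.range_add, add_assoc, Function.comp_def]

theorem isLyndon_segment {f : ℕ → ℕ} {s e : ℕ} :
    IsLyndon (segment f s e) ↔ LyndonFn (fun i => f (s + i)) e := by
  rw [isLyndon_iff, length_segment]
  exact ⟨fun h => h.congr fun i hi => letter_segment hi,
    fun h => h.congr fun i hi => (letter_segment hi).symm⟩

theorem segment_letter (l : List ℕ) : segment (letter l) 0 l.length = l :=
  ext_letter (by simp) fun i hi => by rw [letter_segment (by simpa using hi), zero_add]

theorem segment_congr {f g : ℕ → ℕ} {e : ℕ} (h : ∀ i < e, f i = g i) :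
    segment f 0 e = segment g 0 e :=
  ext_letter (by simp) fun i hi => by
    rw [length_segment] at hi
    rw [letter_segment hi, letter_segment hi, zero_add, h i hi]

/-! ### Duval's algorithm -/

/-- The maximal fractional power of a Lyndon word at position `s` ends at position `j`, and the
length of its period is `q`. -/
def DuvalStop (f : ℕ → ℕ) (len s j q : ℕ) : Prop :=
  LyndonPeriod (fun i => f (s + i)) (j - s) q ∧ j ≤ len ∧ (j < len → f j < f (j - q))

/-- A scan that stops early has met a letter below the periodic continuation, which a prenecklace
excludes; so the scan reaches the end. -/
theorem DuvalStop.lyndonPeriod {f : ℕ → ℕ} {len j q : ℕ} (h : DuvalStop f len 0 j q)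
    (hpre : Prenecklace f len) : LyndonPeriod f len q := by
  obtain ⟨h1, h2, h3⟩ := h
  simp only [zero_add, Nat.sub_zero] at h1
  have := h1.1
  rcases h2.lt_or_eq with hlt | rfl
  · exfalso
    have h4 := hpre q (j - q) (by omega) fun e he => (h1.add (by omega)).symm
    rw [show q + (j - q) = j by omega] at h4
    have := h3 hlt
    omega
  · exact h1

theorem DuvalStop.apply_add {f : ℕ → ℕ} {len s j q c i : ℕ} (h : DuvalStop f len s j q)
    (hi : i < q) (hj : s + c * q + i < j) : f (s + c * q + i) = f (s + i) := by
  have : f (s + (c * q + i)) = f (s + (c * q + i) % q) := h.1.2.2 (c * q + i) (by omega)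
  rwa [← add_assoc, mul_comm c q, Nat.mul_add_mod, Nat.mod_eq_of_lt hi, mul_comm q c] at this

theorem DuvalStop.segment_eq {f : ℕ → ℕ} {len s j q c : ℕ} (h : DuvalStop f len s j q)
    (hj : s + c * q + q ≤ j) : segment f (s + c * q) q = segment f s q :=
  ext_letter (by simp) fun i hi => by
    rw [length_segment] at hi
    rw [letter_segment hi, letter_segment hi, h.apply_add hi (by omega)]

/-- What remains after the whole periods follows u up to position j. A segment of it either ends by
then, and is a prefix of u, or drops below u at j. This keeps the later factors at most u. -/
theorem DuvalStop.segment_le {f : ℕ → ℕ} {len s j q c : ℕ} (h : DuvalStop f len s j q)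
    (hc : s + c * q ≤ j) (hj : j < s + c * q + q) (hsj : s + q ≤ j) {e : ℕ}
    (he : s + c * q + e ≤ len) :
    segment f (s + c * q) e ≤ segment f s q := by
  have heq : ∀ i, s + c * q + i < j → f (s + c * q + i) = f (s + i) := fun i hi =>
    h.apply_add (by omega) hi
  refine le_iff_letter.2 ?_
  simp only [length_segment]
  by_cases hej : s + c * q + e ≤ j
  · refine Or.inr ⟨by omega, fun i hi => ?_⟩
    rw [letter_segment hi, letter_segment (by omega), heq i (by omega)]
  · refine Or.inl ⟨j - (s + c * q), by omega, by omega, fun i hi => ?_, ?_⟩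
    · rw [letter_segment (by omega), letter_segment (by omega), heq i (by omega)]
    · rw [letter_segment (by omega), letter_segment (by omega)]
      have h1 := h.2.2 (by omega)
      have h2 : f (j - q) = f (s + (j - (s + c * q))) := by
        -- At least one whole period was scanned, so position j - q lies in the copy just before the
        -- remainder.
        obtain ⟨c, rfl⟩ : ∃ c', c = c' + 1 := ⟨c - 1, by
          have : c ≠ 0 := by rintro rfl; omega
          omega⟩
        have := h.apply_add (c := c) (i := j - (s + (c + 1) * q)) (by omega)
          (by rw [Nat.add_mul] at *; omega)
        rw [← this]
        congr 1
        rw [Nat.add_mul] at *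
        omega
      rwa [show s + c * q + (j - (s + c * q)) = j by omega, ← h2]

/-- The factors `fs` of the first `s` letters have been found, and their end points are in `g`. -/
structure DuvalInv (f : ℕ → ℕ) (len s : ℕ) (fs : List (List ℕ)) (g : ℕ → ℕ) : Prop where
  isCFL : IsCFL (segment f 0 s) fs
  ends : ∀ q ≤ fs.length, g q = (fs.take q).flatten.length
  first : 0 < s → Prenecklace f len → LyndonPeriod f len (g 1)

theorem DuvalInv.zero (f : ℕ → ℕ) (len : ℕ) {g : ℕ → ℕ} (hg : g 0 = 0) :
    DuvalInv f len 0 [] g := by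
  refine ⟨⟨rfl, by simp, by simp⟩, fun q hq => ?_, fun h => absurd h (lt_irrefl _)⟩
  obtain rfl : q = 0 := by simpa using hq
  simpa using hg

theorem length_le_length_flatten {fs : List (List ℕ)} (h : ∀ a ∈ fs, IsLyndon a) :
    fs.length ≤ fs.flatten.length := by
  induction fs with
  | nil => simp
  | cons a fs ih =>
    have h1 := (isLyndon_iff.1 (h a (by simp))).1
    have h2 := ih fun b hb => h b (by simp [hb])
    simp only [List.length_cons, List.flatten_cons, List.length_append]
    omega

/-- Lyndon words are nonempty, so there are no more factors than letters; this bounds the addresses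
used in `fac`. -/
theorem DuvalInv.length_le {f : ℕ → ℕ} {len s : ℕ} {fs : List (List ℕ)} {g : ℕ → ℕ}
    (h : DuvalInv f len s fs g) : fs.length ≤ s := by
  have := length_le_length_flatten h.isCFL.2.1
  rwa [h.isCFL.1, length_segment] at this

/-- Every copy cut off equals the first period, which is Lyndon and is at most all earlier factors,
so the factorization stays nonincreasing. -/
theorem DuvalInv.emit {f : ℕ → ℕ} {len s₀ j q c : ℕ} {fs : List (List ℕ)} {g : ℕ → ℕ}
    (hmax : DuvalStop f len s₀ j q) (hc : s₀ + c * q + q ≤ j)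
    (h : DuvalInv f len (s₀ + c * q) fs g) (hle : ∀ a ∈ fs, segment f s₀ q ≤ a) :
    DuvalInv f len (s₀ + c * q + q) (fs ++ [segment f s₀ q])
      (Function.update g (fs.length + 1) (s₀ + c * q + q)) := by
  obtain ⟨⟨h1, h2, h3⟩, h4, h5⟩ := h
  have hlyn : IsLyndon (segment f s₀ q) := isLyndon_segment.2 hmax.1.2.1
  have hflat : (fs ++ [segment f s₀ q]).flatten = segment f 0 (s₀ + c * q + q) := by
    rw [segment_add, zero_add, hmax.segment_eq hc, ← h1]
    simp
  refine ⟨⟨hflat, fun a ha => ?_, ?_⟩, fun r hr => ?_, fun _ hpre => ?_⟩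
  · rcases List.mem_append.1 ha with ha | ha
    · exact h2 a ha
    · rwa [List.mem_singleton.1 ha]
  · refine List.pairwise_append.2 ⟨h3, List.pairwise_singleton _ _, fun a ha b hb => ?_⟩
    rw [List.mem_singleton.1 hb]
    exact hle a ha
  · rw [List.length_append, List.length_singleton] at hr
    rcases hr.lt_or_eq with hlt | rfl
    · rw [Function.update_of_ne hlt.ne, List.take_append_of_le_length (by omega), h4 r (by omega)]
    · rw [Function.update_self, List.take_of_length_le (by simp), hflat, length_segment]
  -- Cell 1 of `fac` is written only when the very first factor is cut off; later factors leave it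
  -- unchanged.
  · rcases Nat.eq_zero_or_pos (s₀ + c * q) with h0 | hpos
    · have hs : s₀ = 0 := by omega
      have hfs : fs.length = 0 := by
        have := length_le_length_flatten h2
        rw [h1, length_segment] at this
        omega
      subst hs
      rw [hfs, h0, zero_add, zero_add, Function.update_self]
      exact hmax.lyndonPeriod hpre
    · have hfs : fs.length ≠ 0 := by
        intro h0
        have := congrArg List.length h1
        rw [List.length_eq_zero_iff.1 h0, length_segment] at this
        simp at this
        omega
      rw [Function.update_of_ne (by omega)]
      exact h5 hpos hpre

/-- The inner loop of Duval's algorithm, which extends a fractional power as far as possible. -/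
theorem runs_duval_extend {M W : ℕ} {s : State} {f : ℕ → ℕ} {len S : ℕ}
    (hf : s.arr .x = f) (hlen : s.reg .len = len) (hS : s.reg .s = S) (hM : len ≤ M) (hW : len ≤ W)
    (hSlen : S < len) (hj : s.reg .j = S + 1) (hp : s.reg .p = S) :
    Runs M W (.loop (.and (.lt (.reg .j) (.reg .len))
        (.le (.read .x (.reg .p)) (.read .x (.reg .j)))) (block [
      .cond (.lt (.read .x (.reg .p)) (.read .x (.reg .j)))
        (.assign .p (.reg .s))
        (incr .p),
      incr .j])) s fun s' T =>
        DuvalStop f len S (s'.reg .j) (s'.reg .j - s'.reg .p) ∧ S ≤ s'.reg .p ∧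
          s'.reg .p < s'.reg .j ∧ T ≤ 30 * (s'.reg .j - S) := by
  -- The period is not stored: it is the distance between the pointers j and p, where p marks the
  -- letter to be compared with the one at j.
  refine runs_loop
    (fun s' => LyndonPeriod (fun i => f (S + i)) (s'.reg .j - S) (s'.reg .j - s'.reg .p) ∧
      S ≤ s'.reg .p ∧ s'.reg .p < s'.reg .j ∧ s'.reg .j ≤ len)
    (fun s' => 30 * (len - s'.reg .j)) ?_ ?_ ?_ ?_
  · rw [hj, hp]
    refine ⟨?_, by omega, by omega, by omega⟩
    simpa using (lyndonFn_one _).lyndonPeriod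
  · rintro s' hF ⟨h1, h2, h3, h4⟩
    have e1 : s'.reg .len = len := (hF.1 .len rfl).trans hlen
    simp [Test.inBounds, Test.holds, Expr.inBounds, Expr.eval, e1]
    omega
  · rintro s' hF ⟨h1, h2, h3, h4⟩ hh
    have e1 : s'.reg .len = len := (hF.1 .len rfl).trans hlen
    have e2 : s'.arr .x = f := (hF.2 .x rfl).trans hf
    have e3 : s'.reg .s = S := (hF.1 .s rfl).trans hS
    simp only [Test.holds, Expr.eval, e1, e2] at hh
    obtain ⟨hh1, hh2⟩ := hh
    have hsub : s'.reg .j - S - (s'.reg .j - s'.reg .p) = s'.reg .p - S := by omega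
    simp [block, incr, runs_seq, runs_assign, runs_skip, runs_cond, Test.inBounds, Test.holds,
      Expr.inBounds, Expr.eval, Expr.cost, Test.cost, e2, e3]
    refine ⟨by omega, fun hlt => ⟨by omega, by omega, ?_, by omega⟩,
      fun hge => ⟨by omega, by omega, ?_, by omega⟩⟩
    · refine ⟨?_, by omega, by omega⟩
      have := (h1.lyndonFn_succ_of_lt (by
        show f (S + _) < f (S + _)
        rw [hsub, show S + (s'.reg .p - S) = s'.reg .p by omega,
          show S + (s'.reg .j - S) = s'.reg .j by omega]
        exact hlt)).lyndonPeriod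
      rwa [show s'.reg .j - S + 1 = s'.reg .j + 1 - S by omega] at this
    · refine ⟨?_, by omega, by omega⟩
      have := h1.succ_of_eq (by
        show f (S + _) = f (S + _)
        rw [hsub, show S + (s'.reg .p - S) = s'.reg .p by omega,
          show S + (s'.reg .j - S) = s'.reg .j by omega]
        omega)
      rwa [show s'.reg .j - S + 1 = s'.reg .j + 1 - S by omega] at this
  · rintro s' T hF ⟨h1, h2, h3, h4⟩ hh hT
    have e1 : s'.reg .len = len := (hF.1 .len rfl).trans hlen
    have e2 : s'.arr .x = f := (hF.2 .x rfl).trans hf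
    simp only [Test.holds, Expr.eval, e1, e2] at hh
    simp [Test.cost, Expr.cost, hj] at hT
    refine ⟨⟨h1, h4, fun hlt => ?_⟩, h2, h3, by omega⟩
    rw [show s'.reg .j - (s'.reg .j - s'.reg .p) = s'.reg .p by omega]
    by_contra hge
    exact hh ⟨hlt, by omega⟩

/-- The second inner loop of Duval's algorithm, which cuts off copies of the period. -/
theorem runs_duval_emit {M W : ℕ} {s : State} {f : ℕ → ℕ} {len S J P : ℕ} {fs : List (List ℕ)}
    (hS : s.reg .s = S) (hj : s.reg .j = J) (hp : s.reg .p = P) (hM : len + 1 ≤ M) (hW : len ≤ W)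
    (hmax : DuvalStop f len S J (J - P)) (hSP : S ≤ P) (hPJ : P < J)
    (hinv : DuvalInv f len S fs (s.arr .fac)) (hm : s.reg .m = fs.length)
    (hle : ∀ a ∈ fs, segment f S (J - P) ≤ a) :
    Runs M W (.loop (.le (.reg .s) (.reg .p)) (block [
      .assign .s (.plus (.reg .s) (.minus (.reg .j) (.reg .p))),
      incr .m,
      .store .fac (.reg .m) (.reg .s)])) s fun s' T =>
        ∃ fs, DuvalInv f len (s'.reg .s) fs (s'.arr .fac) ∧ s'.reg .m = fs.length ∧
          s'.reg .s ≤ len ∧ J - S < 2 * (s'.reg .s - S) ∧ T ≤ 30 * (s'.reg .s - S) + 30 ∧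
          S < s'.reg .s ∧
          ∀ a ∈ fs, ∀ e, s'.reg .s + e ≤ len → segment f (s'.reg .s) e ≤ a := by
  have hJ := hmax.2.1
  refine runs_loop
    (fun s' => ∃ c fs, s'.reg .s = S + c * (J - P) ∧ s'.reg .s ≤ J ∧
      DuvalInv f len (s'.reg .s) fs (s'.arr .fac) ∧ s'.reg .m = fs.length ∧
      ∀ a ∈ fs, segment f S (J - P) ≤ a)
    (fun s' => 30 * (J - s'.reg .s)) ?_ ?_ ?_ ?_
  · exact ⟨0, fs, by simp [hS], by omega, hS ▸ hinv, hm, hle⟩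
  · intro s' _ _
    simp [Test.inBounds, Expr.inBounds]
  · rintro s' hF ⟨c, fs, h1, h2, h3, h4, h5⟩ hh
    have e1 : s'.reg .j = J := (hF.1 .j rfl).trans hj
    have e2 : s'.reg .p = P := (hF.1 .p rfl).trans hp
    simp only [Test.holds, Expr.eval, e2] at hh
    have hlen := h3.length_le
    have hcq : S + c * (J - P) + (J - P) ≤ J := by omega
    rw [h1] at h3
    have hemit := DuvalInv.emit hmax hcq h3 h5
    simp [block, incr, runs_seq, runs_assign, runs_skip, runs_store,
      Expr.inBounds, Expr.eval, Expr.cost, Test.cost, e1, e2]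
    refine ⟨by omega, by omega, by omega, by omega,
      ⟨⟨c + 1, by rw [Nat.add_mul, h1]; omega⟩, by omega, fs ++ [segment f S (J - P)], ?_,
        by simp [h4], ?_⟩, by omega⟩
    · rw [h1, h4]; exact hemit
    · intro a ha
      rcases List.mem_append.1 ha with ha | ha
      · exact h5 a ha
      · rw [List.mem_singleton.1 ha]
  · rintro s' T hF ⟨c, fs, h1, h2, h3, h4, h5⟩ hh hT
    have e2 : s'.reg .p = P := (hF.1 .p rfl).trans hp
    simp only [Test.holds, Expr.eval, e2] at hh
    simp [Test.cost, Expr.cost, hS] at hT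
    -- At least one period has been cut off, and what is left is shorter than a period; hence the
    -- advance of s exceeds half of J - S.
    have hc : J - P ≤ c * (J - P) := by
      refine Nat.le_mul_of_pos_left _ (Nat.pos_of_ne_zero ?_)
      rintro rfl
      omega
    refine ⟨fs, h3, h4, by omega, by omega, by omega, by omega, fun a ha e he => ?_⟩
    rw [h1] at he ⊢
    exact (hmax.segment_le (by omega) (by omega) (by omega) he).trans (h5 a ha)

/-- Duval's algorithm is correct and takes linear time. -/
theorem runs_duval {M W : ℕ} {s : State} {f : ℕ → ℕ} {len : ℕ}
    (hf : s.arr .x = f) (hlen : s.reg .len = len) (hM : len + 1 ≤ M) (hW : len ≤ W) :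
    Runs M W duval s fun s' T => ∃ fs, DuvalInv f len len fs (s'.arr .fac) ∧
      s'.reg .m = fs.length ∧ T ≤ 200 * len + 20 := by
  rw [duval]
  simp [block, runs_seq, runs_assign, runs_skip, runs_store, Expr.inBounds, Expr.eval, Expr.cost]
  refine ⟨by omega, ?_⟩
  -- The last clause says that any segment starting at s is at most every factor found so far; it is
  -- what makes the next period eligible as a factor.
  refine runs_loop
    (fun s' => ∃ fs, DuvalInv f len (s'.reg .s) fs (s'.arr .fac) ∧ s'.reg .m = fs.length ∧
      s'.reg .s ≤ len ∧ ∀ a ∈ fs, ∀ e, s'.reg .s + e ≤ len → segment f (s'.reg .s) e ≤ a)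
    (fun s' => 200 * (len - s'.reg .s)) ?_ ?_ ?_ ?_
  · refine ⟨[], ?_, by simp, by simp, by simp⟩
    simpa using DuvalInv.zero f len (by simp)
  · intro s' _ _
    simp [Test.inBounds, Expr.inBounds]
  · rintro s₁ hF ⟨fs, h1, h2, h3, h4⟩ hh
    have e1 : s₁.reg .len = len := (hF.1 .len rfl).trans hlen
    have e2 : s₁.arr .x = f := (hF.2 .x rfl).trans hf
    simp only [Test.holds, Expr.eval, e1] at hh
    simp only [runs_seq, runs_assign, Expr.inBounds, Expr.eval, Expr.cost, true_and]
    refine ⟨by omega, by simpa using by omega, ?_⟩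
    refine (runs_duval_extend (f := f) (len := len) (S := s₁.reg .s)
      (by simpa using e2) (by simpa using e1)
      (by simp) (by omega) hW hh (by simp) (by simp)).mono ?_
    rintro s₂ T₂ hF₂ ⟨hmax, hp1, hp2, hT₂⟩
    have e3 : s₂.reg .s = s₁.reg .s := by simpa using hF₂.1 .s rfl
    have e4 : s₂.reg .m = s₁.reg .m := by simpa using hF₂.1 .m rfl
    have e5 : s₂.arr .fac = s₁.arr .fac := by simpa using hF₂.2 .fac rfl
    have hJ := hmax.2.1
    refine (runs_duval_emit (f := f) (len := len) (fs := fs) e3 rfl rfl hM hW hmax hp1 hp2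
      (by rwa [e5]) (by rwa [e4]) (fun a ha => h4 a ha _ (by omega))).mono ?_
    rintro s₃ T₃ hF₃ ⟨fs', h1', h2', h3', h5', h6', h7', h4'⟩
    simp only [runs_skip]
    refine ⟨⟨fs', h1', h2', h3', h4'⟩, ?_⟩
    -- With Δ ≥ 1 the advance of s, scanning costs less than 60Δ and cutting at most 30Δ + 30, so a
    -- potential of 200 per letter also covers the fixed costs.
    simp only [Test.cost, Expr.cost]
    omega
  · rintro s' T hF ⟨fs, h1, h2, h3, -⟩ hh hT
    have e1 : s'.reg .len = len := (hF.1 .len rfl).trans hlen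
    simp only [Test.holds, Expr.eval, e1] at hh
    simp [Test.cost, Expr.cost] at hT
    have : s'.reg .s = len := by omega
    rw [this] at h1
    exact ⟨fs, h1, h2, by omega⟩

/-- Existence is read off from a run of the verified program on a state whose array `x` holds the
word. -/
theorem exists_isCFL (x : List ℕ) : ∃ fs, IsCFL x fs := by
  obtain ⟨s', T, -, fs, h, -, -⟩ := runs_duval (M := x.length + 1) (W := x.length)
    (s := ⟨fun _ => x.length, fun _ => letter x⟩) rfl rfl le_rfl le_rfl
  have := h.isCFL
  rw [segment_letter] at this
  exact ⟨fs, this⟩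

/-! ### The subprograms -/

theorem letter_cons_succ (a : ℕ) (l : List ℕ) (i : ℕ) : letter (a :: l) (i + 1) = letter l i := by
  simp [letter]

theorem letter_cons_zero (a : ℕ) (l : List ℕ) : letter (a :: l) 0 = a := by
  simp [letter]

/-- The input `σ w` and the numbers `n = |w| + 1` and `k` are in their places, and memory cells
are large enough for them. -/
structure HasInput (M W k σ : ℕ) (w : List ℕ) (s : State) : Prop where
  n : s.reg .n = w.length + 1
  k : s.reg .k = k
  inp : s.arr .inp = letter (σ :: w)
  letter_le : ∀ i, letter (σ :: w) i ≤ W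
  length_lt_M : w.length + 1 < M
  length_le_W : w.length + 1 ≤ W

theorem HasInput.of_frame {M W k σ : ℕ} {w : List ℕ} {s s' : State} {c : Prog}
    (h : HasInput M W k σ w s) (hF : Frame c s s') (hn : c.writesReg .n = false)
    (hk : c.writesReg .k = false) (hi : c.writesArr .inp = false) : HasInput M W k σ w s' :=
  ⟨(hF.1 _ hn).trans h.n, (hF.1 _ hk).trans h.k, (hF.2 _ hi).trans h.inp, h.letter_le,
    h.length_lt_M, h.length_le_W⟩

/-- The hypothesis on `e` ranges over all framed states because `e` is evaluated only after the
copying loop, when j and the array `b` have changed. -/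
theorem runs_writeShift {M W k σ : ℕ} {w : List ℕ} {s : State} {b : Arr} {e : Expr} {y : ℕ}
    (hI : HasInput M W k σ w s) (hb : b ≠ .inp) (hy : y ≤ W)
    (he : ∀ s', Frame (writeShift b e) s s' → e.inBounds M s' ∧ e.eval s' = y) :
    Runs M W (writeShift b e) s fun s' T =>
      (∀ i ≤ w.length, s'.arr b i = letter (w ++ [y]) i) ∧ T ≤ 30 * w.length + e.cost + 30 := by
  have hM := hI.length_lt_M
  have hW := hI.length_le_W
  have hlet := hI.letter_le
  rw [writeShift]
  simp only [block, runs_seq, runs_assign, runs_skip, Expr.inBounds, Expr.eval,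
    Expr.cost, true_and]
  refine ⟨Nat.zero_le _, ?_⟩
  refine runs_loop
    (fun s' => s'.reg .j ≤ w.length ∧ ∀ i < s'.reg .j, s'.arr b i = letter (w ++ [y]) i)
    (fun s' => 30 * (w.length - s'.reg .j)) ?_ ?_ ?_ ?_
  · simp
  · intro s' _ _
    simp [Test.inBounds, Expr.inBounds]
  · rintro s' hF ⟨h1, h2⟩ hh
    have e1 : s'.reg .n = w.length + 1 := (hF.1 .n rfl).trans hI.n
    have e2 : s'.arr .inp = letter (σ :: w) :=
      (hF.2 .inp (by simpa [Prog.writesArr, incr] using hb.symm)).trans hI.inp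
    simp only [Test.holds, Expr.eval, e1] at hh
    simp [incr, runs_seq, runs_assign, runs_skip, runs_store,
      Expr.inBounds, Expr.eval, Expr.cost, Test.cost, e2]
    refine ⟨by omega, by omega, hlet _, by omega, ⟨by omega, fun i hi => ?_⟩, by omega⟩
    rcases hi.lt_or_eq with hi | rfl
    · rw [Function.update_of_ne hi.ne, h2 i hi]
    · rw [Function.update_self, letter_cons_succ, letter_append_left (by omega)]
  · rintro s' T hF ⟨h1, h2⟩ hh hT
    have e1 : s'.reg .n = w.length + 1 := (hF.1 .n rfl).trans hI.n
    simp only [Test.holds, Expr.eval, e1] at hh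
    simp [Test.cost, Expr.cost] at hT
    obtain ⟨he1, he2⟩ := he s' (Frame.trans (s' := s.setReg .j 0)
      ⟨fun v hv => by
        have : v ≠ .j := by
          rintro rfl
          simp [writeShift, block, Prog.writesReg] at hv
        simp [this], fun _ _ => rfl⟩
      (hF.mono (by simp +contextual [writeShift, block, Prog.writesReg])
        (by simp +contextual [writeShift, block, Prog.writesArr])))
    simp [runs_store, Expr.inBounds, Expr.eval, Expr.cost, e1, he1, he2]
    refine ⟨by omega, by omega, fun i hi => ?_, by omega⟩
    rcases hi.lt_or_eq with hlt | rfl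
    · rw [Function.update_of_ne hlt.ne, h2 i (by omega)]
    · rw [Function.update_self, letter_append_length]

/-- The end points in `g` determine the first and the last factor, so their equality becomes a
comparison of lengths and letters that the program can carry out. -/
theorem DuvalInv.head?_eq_getLast?_iff {f : ℕ → ℕ} {len : ℕ} {fs : List (List ℕ)} {g : ℕ → ℕ}
    (h : DuvalInv f len len fs g) (hlen : 0 < len) :
    0 < fs.length ∧ 0 < g 1 ∧ g 1 ≤ len ∧ g (fs.length - 1) ≤ len ∧
      (fs.head? = fs.getLast? ↔
        g 1 = len - g (fs.length - 1) ∧ ∀ e < g 1, f e = f (g (fs.length - 1) + e)) := by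
  obtain ⟨⟨h1, h2, -⟩, h3, -⟩ := h
  have hfs : fs ≠ [] := by
    rintro rfl
    have := congrArg List.length h1
    simp at this
    omega
  have hpos := List.length_pos_iff.2 hfs
  have h31 := h3 1 hpos
  have h32 := h3 (fs.length - 1) (by omega)
  rw [← List.dropLast_eq_take] at h32
  set a := fs.head hfs with ha
  set b := fs.getLast hfs with hb
  have hxa : segment f 0 len = a ++ fs.tail.flatten := by
    rw [← h1]; conv_lhs => rw [← List.cons_head_tail hfs]
    rw [List.flatten_cons]
  have hxb : segment f 0 len = fs.dropLast.flatten ++ b := by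
    rw [← h1]; conv_lhs => rw [← List.dropLast_append_getLast hfs]
    simp [hb]
  have hla := (isLyndon_iff.1 (h2 a (List.head_mem hfs))).1
  have hga : g 1 = a.length := by
    rw [h31, List.take_one, List.head?_eq_some_head hfs]
    simp [ha]
  have hlena : a.length ≤ len := by
    have := congrArg List.length hxa
    simp only [length_segment, List.length_append] at this
    omega
  have hlenb : len = g (fs.length - 1) + b.length := by
    have := congrArg List.length hxb
    simp only [length_segment, List.length_append] at this
    omega
  have hta : ∀ i < a.length, f i = letter a i := fun i hi => by
    rw [← letter_append_left (l' := fs.tail.flatten) hi, ← hxa, letter_segment (by omega), zero_add]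
  have htb : ∀ i < b.length, f (g (fs.length - 1) + i) = letter b i := fun i hi => by
    rw [← letter_append_right (l := fs.dropLast.flatten), ← hxb, ← h32, letter_segment (by omega),
      zero_add]
  refine ⟨hpos, by omega, by omega, by omega, ?_⟩
  rw [List.head?_eq_some_head hfs, List.getLast?_eq_some_getLast hfs, Option.some_inj,
    ← ha, ← hb, hga]
  constructor
  · intro hab
    refine ⟨by rw [hab]; omega, fun e he => ?_⟩
    rw [hta e he, htb e (hab ▸ he), hab]
  · rintro ⟨hl, he⟩
    refine ext_letter (by omega) fun i hi => ?_
    rw [← hta i hi, ← htb i (by omega), he i hi]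

theorem isGreatest_prefix {K i : ℕ} {v : List ℕ} (hi : i < v.length)
    (h : ∀ j < i, letter v j = K) (hne : letter v i ≠ K) :
    IsGreatest {i : ℕ | List.replicate i K <+: v} i := by
  have hv : v = List.replicate i K ++ v.drop i := by
    conv_lhs => rw [← List.take_append_drop i v]
    congr 1
    refine ext_letter (by simp; omega) fun j hj => ?_
    rw [List.length_take_of_le hi.le] at hj
    rw [letter_take hj, h j hj, letter_replicate hj]
  rw [hv]
  refine isGreatest_replicate_prefix (fun h0 => ?_) fun h0 => ?_
  · have := congrArg List.length h0
    simp at this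
    omega
  · rw [List.head?_drop, List.getElem?_eq_getElem hi, Option.some_inj] at h0
    exact hne (by rw [letter_eq_getElem hi, h0])

/-- The final comparison of the first and the last factor. -/
theorem runs_compare {M W : ℕ} {s : State} {f : ℕ → ℕ} {N : ℕ} {fs : List (List ℕ)}
    (hN : 0 < N) (hM : N < M) (hW : N ≤ W) (hn : s.reg .n = N) (hf : s.arr .x = f)
    (hinv : DuvalInv f N N fs (s.arr .fac)) (hm : s.reg .m = fs.length) :
    Runs M W (.cond (.eq (.read .fac (.lit 1))
      (.minus (.reg .n) (.read .fac (.minus (.reg .m) (.lit 1)))))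
    (block [
      .assign .h (.lit 1),
      .assign .j (.lit 0),
      .loop (.lt (.reg .j) (.read .fac (.lit 1))) (block [
        .cond (.eq (.read .x (.reg .j))
            (.read .x (.plus (.read .fac (.minus (.reg .m) (.lit 1))) (.reg .j))))
          .skip
          (.assign .h (.lit 0)),
        incr .j])])
    (.assign .h (.lit 0))) s fun s' T =>
      (s'.reg .h = 1 ↔ fs.head? = fs.getLast?) ∧ T ≤ 50 * N + 50 := by
  have hlen := hinv.length_le
  obtain ⟨hpos, hg1, hg1N, hgm, hiff⟩ := hinv.head?_eq_getLast?_iff hN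
  rw [hiff]
  generalize hgdef : s.arr .fac = g at *
  simp only [runs_cond, Test.inBounds, Expr.inBounds, Test.holds, Expr.eval, runs_assign, hgdef,
    hm, hn, block, runs_seq, Expr.cost, Test.cost, true_and, and_true]
  refine ⟨⟨by omega, by omega⟩, fun heq => ⟨by omega, Nat.zero_le _, ?_⟩, fun hne =>
    ⟨Nat.zero_le _, ?_, by omega⟩⟩
  · refine runs_loop
      (fun s' => s'.reg .j ≤ g 1 ∧
        (s'.reg .h = 1 ↔ ∀ e < s'.reg .j, f e = f (g (fs.length - 1) + e)))
      (fun s' => 40 * (g 1 - s'.reg .j)) ?_ ?_ ?_ ?_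
    · simp
    · intro s' hF _
      simp [Test.inBounds, Expr.inBounds, Expr.eval]
      omega
    · rintro s' hF ⟨h1, h2⟩ hh
      have e1 : s'.reg .m = fs.length := (hF.1 .m rfl).trans hm
      have e2 : s'.arr .x = f := (hF.2 .x rfl).trans hf
      have e3 : s'.arr .fac = g := (hF.2 .fac rfl).trans hgdef
      simp only [Test.holds, Expr.eval, e3] at hh
      simp [incr, runs_seq, runs_assign, runs_skip, runs_cond, Test.inBounds, Test.holds,
        Expr.inBounds, Expr.eval, Expr.cost, Test.cost, e1, e2, e3]
      refine ⟨by omega, fun hx => ⟨by omega, ⟨by omega, ?_⟩, by omega⟩,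
        fun hx => ⟨by omega, ⟨by omega, s'.reg .j, by omega, hx⟩, by omega⟩⟩
      rw [h2]
      refine ⟨fun h e he => ?_, fun h e he => h e (by omega)⟩
      rcases he.lt_or_eq with he | rfl
      · exact h e he
      · exact hx
    · rintro s' T hF ⟨h1, h2⟩ hh hT
      have e3 : s'.arr .fac = g := (hF.2 .fac rfl).trans hgdef
      simp only [Test.holds, Expr.eval, e3] at hh
      simp [Test.cost, Expr.cost] at hT
      rw [runs_skip, h2, show s'.reg .j = g 1 by omega]
      exact ⟨⟨fun h => ⟨heq, h⟩, fun h => h.2⟩, by omega⟩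
  · simp only [State.setReg_reg, if_true]
    exact ⟨fun h => absurd h (by decide), fun h => absurd h.1 hne⟩

/-- The evaluation of the head predicate is correct and takes linear time. -/
theorem runs_headTest {M W k ρ : ℕ} {w : List ℕ} {s : State} (hn : s.reg .n = w.length + 1)
    (hk : s.reg .k = k) (hM : w.length + 1 < M) (hW : w.length + 1 ≤ W) (hρ : ρ < k - 1)
    (hbuf : ∀ i ≤ w.length, s.arr .buf i = letter (w ++ [ρ]) i)
    (hlet : ∀ i, letter (w ++ [ρ]) i ≤ W) :
    Runs M W headTest s fun s' T =>
      (s'.reg .h = 1 ↔ Head k (w ++ [ρ])) ∧ T ≤ 400 * w.length + 700 := by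
  have hlast : letter (w ++ [ρ]) w.length = ρ := letter_append_length _ _
  have hlv : (w ++ [ρ]).length = w.length + 1 := by simp
  generalize hv : w ++ [ρ] = v at *
  rw [headTest, block, runs_seq]
  simp only [runs_assign, Expr.inBounds, Expr.eval, Expr.cost, true_and]
  refine ⟨Nat.zero_le _, ?_⟩
  rw [block, runs_seq]
  refine runs_loop
    (fun s' => s'.reg .i ≤ w.length ∧ ∀ j < s'.reg .i, letter v j = k - 1)
    (fun s' => 30 * (w.length - s'.reg .i)) ?_ ?_ ?_ ?_
  · simp
  · rintro s' hF ⟨h1, -⟩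
    have e1 : s'.reg .n = w.length + 1 := (hF.1 .n rfl).trans hn
    simp [Test.inBounds, Expr.inBounds, Expr.eval, Test.holds, maxLetter]
    omega
  · rintro s' hF ⟨h1, h2⟩ hh
    have e2 : s'.arr .buf = s.arr .buf := hF.2 .buf rfl
    have e3 : s'.reg .k = k := (hF.1 .k rfl).trans hk
    simp only [Test.holds, Expr.eval, maxLetter, e2, e3] at hh
    rw [hbuf _ h1] at hh
    -- The last letter is ρ < k-1, so the scan for letters k-1 stops there at the latest.
    have hlt : s'.reg .i < w.length := lt_of_le_of_ne h1 fun h0 => by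
      rw [h0, hlast] at hh
      omega
    simp [incr, runs_assign, Expr.inBounds, Expr.eval, Expr.cost, Test.cost, maxLetter]
    refine ⟨by omega, ⟨by omega, fun j hj => ?_⟩, by omega⟩
    rcases hj.lt_or_eq with hj | rfl
    · exact h2 j hj
    · exact hh.2
  rintro s₁ T₁ hF₁ ⟨hi1, hi2⟩ hh hT₁
  have n₁ : s₁.reg .n = w.length + 1 := (hF₁.1 .n rfl).trans hn
  have k₁ : s₁.reg .k = k := (hF₁.1 .k rfl).trans hk
  have b₁ : s₁.arr .buf = s.arr .buf := hF₁.2 .buf rfl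
  simp only [Test.holds, Expr.eval, maxLetter, b₁, k₁, n₁] at hh
  rw [hbuf _ hi1] at hh
  simp [Test.cost, Expr.cost, maxLetter] at hT₁
  have hgreat : IsGreatest {i : ℕ | List.replicate i (k - 1) <+: v} (s₁.reg .i) :=
    isGreatest_prefix (by omega) hi2 fun h0 => hh ⟨by omega, h0⟩
  generalize hi : s₁.reg .i = i at *
  have hhead : Head k v ↔ IsExpandedLyndon (v.rotate i) := by
    rw [← hv] at hgreat ⊢
    exact head_iff_isExpandedLyndon_rotate hρ hgreat
  have hrot : ∀ e ≤ w.length, letter (v.rotate i) e =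
      if i + e < w.length + 1 then letter v (i + e) else letter v (i + e - (w.length + 1)) := by
    intro e he
    rw [letter_rotate (by omega), hlv, add_comm e i]
    split_ifs with h
    · rw [Nat.mod_eq_of_lt h]
    · rw [Nat.mod_eq_sub_mod (by omega), Nat.mod_eq_of_lt (by omega)]
  rw [block, runs_seq]
  simp only [runs_assign, Expr.inBounds, Expr.eval, Expr.cost, true_and]
  refine ⟨Nat.zero_le _, ?_⟩
  rw [block, runs_seq]
  refine runs_loop
    (fun s' => s'.reg .j ≤ w.length + 1 ∧ ∀ e < s'.reg .j, s'.arr .x e = letter (v.rotate i) e)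
    (fun s' => 40 * (w.length + 1 - s'.reg .j)) ?_ ?_ ?_ ?_
  · simp
  · intro s' _ _
    simp [Test.inBounds, Expr.inBounds]
  · rintro s' hF ⟨h1, h2⟩ hh
    have e1 : s'.reg .n = w.length + 1 := (hF.1 .n rfl).trans n₁
    have e2 : s'.arr .buf = s.arr .buf := (hF.2 .buf rfl).trans b₁
    have e3 : s'.reg .i = i := (hF.1 .i rfl).trans hi
    simp only [Test.holds, Expr.eval, e1] at hh
    simp [block, incr, runs_seq, runs_assign, runs_skip, runs_cond, runs_store, Test.inBounds,
      Test.holds, Expr.inBounds, Expr.eval, Expr.cost, Test.cost, e1, e2, e3]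
    have hr := hrot (s'.reg .j) (by omega)
    refine ⟨fun hlt => ⟨by omega, by omega, ?_, by omega, ⟨by omega, fun e he => ?_⟩, by omega⟩,
      fun hge => ⟨by omega, by omega, ?_, by omega, ⟨by omega, fun e he => ?_⟩, by omega⟩⟩
    · rw [hbuf _ (by omega)]; exact hlet _
    · rw [if_pos (by omega)] at hr
      rcases he.lt_or_eq with he | rfl
      · rw [Function.update_of_ne he.ne, h2 e he]
      · rw [Function.update_self, hr, hbuf _ (by omega)]
    · rw [hbuf _ (by omega)]; exact hlet _
    · rw [if_neg (by omega)] at hr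
      rcases he.lt_or_eq with he | rfl
      · rw [Function.update_of_ne he.ne, h2 e he]
      · rw [Function.update_self, hr, hbuf _ (by omega)]
  rintro s₂ T₂ hF₂ ⟨hj1, hj2⟩ hh₂ hT₂
  have n₂ : s₂.reg .n = w.length + 1 := (hF₂.1 .n rfl).trans n₁
  simp only [Test.holds, Expr.eval, n₂] at hh₂
  simp [Test.cost, Expr.cost] at hT₂
  rw [show s₂.reg .j = w.length + 1 by omega] at hj2
  have hseg : segment (s₂.arr .x) 0 (w.length + 1) = v.rotate i := by
    rw [segment_congr hj2]
    conv_rhs => rw [← segment_letter (v.rotate i)]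
    rw [List.length_rotate, hlv]
  rw [block, runs_seq]
  simp only [runs_assign, Expr.inBounds, Expr.eval, Expr.cost, true_and, n₂]
  refine ⟨hW, ?_⟩
  rw [block, runs_seq]
  refine (runs_duval (f := s₂.arr .x) (len := w.length + 1) (by simp) (by simp) (by omega)
    hW).mono ?_
  rintro s₃ T₃ hF₃ ⟨fs, hinv, hm, hT₃⟩
  have n₃ : s₃.reg .n = w.length + 1 := (hF₃.1 .n rfl).trans n₂
  have x₃ : s₃.arr .x = s₂.arr .x := hF₃.2 .x rfl
  rw [block, runs_seq]
  refine (runs_compare (Nat.succ_pos _) hM hW n₃ x₃ hinv hm).mono ?_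
  rintro s₄ T₄ - ⟨hres, hT₄⟩
  rw [block, runs_skip, hhead, hres]
  have hcfl := hinv.isCFL
  rw [hseg] at hcfl
  refine ⟨(hcfl.isExpandedLyndon_iff ?_).symm, by omega⟩
  intro h0
  have := congrArg List.length h0
  rw [List.length_rotate, hlv] at this
  simp at this

/-- The letter `σ'` is found in linear time. -/
theorem runs_findLetter {M W k σ t : ℕ} {w w' : List ℕ} {s : State}
    (hI : HasInput M W k σ w s) (hw : w = List.replicate t (k - 1) ++ w') (hne : w' ≠ [])
    (hhd : w'.head? ≠ some (k - 1)) (hpre : Prenecklace (letter w') w'.length) :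
    Runs M W findLetter s fun s' T => (∃ q, LyndonPeriod (letter w') w'.length q ∧
      s'.reg .sig = letter w' (w'.length % q)) ∧ T ≤ 400 * w.length + 400 := by
  have hM := hI.length_lt_M
  have hW := hI.length_le_W
  have hlet := hI.letter_le
  have hlw : w.length = t + w'.length := by rw [hw]; simp
  have hpos := List.length_pos_iff.2 hne
  have hw1 : ∀ i < t, letter (σ :: w) (i + 1) = k - 1 := fun i hi => by
    rw [letter_cons_succ, hw, letter_append_left (by simpa using hi), letter_replicate hi]
  have hw2 : ∀ i, letter (σ :: w) (t + 1 + i) = letter w' i := fun i => by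
    rw [add_right_comm, letter_cons_succ, hw]
    have := letter_append_right (l := List.replicate t (k - 1)) (l' := w') i
    rwa [List.length_replicate] at this
  have hw3 : letter (σ :: w) (t + 1) ≠ k - 1 := by
    have := hw2 0
    rw [Nat.add_zero] at this
    rw [this, letter_eq_getElem hpos]
    intro h0
    rw [List.head?_eq_getElem?, List.getElem?_eq_getElem hpos, h0] at hhd
    exact hhd rfl
  rw [findLetter, block, runs_seq]
  simp only [runs_assign, Expr.inBounds, Expr.eval, Expr.cost, true_and]
  refine ⟨Nat.zero_le _, ?_⟩
  rw [block, runs_seq]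
  refine runs_loop (fun s' => s'.reg .t ≤ t) (fun s' => 30 * (t - s'.reg .t)) ?_ ?_ ?_ ?_
  · simp
  · rintro s' hF h1
    simp [Test.inBounds, Expr.inBounds, Expr.eval, Test.holds, maxLetter]
    omega
  · rintro s' hF h1 hh
    have e2 : s'.arr .inp = letter (σ :: w) := (hF.2 .inp rfl).trans hI.inp
    have e3 : s'.reg .k = k := (hF.1 .k rfl).trans hI.k
    simp only [Test.holds, Expr.eval, maxLetter, e2, e3] at hh
    have hlt : s'.reg .t < t := lt_of_le_of_ne h1 fun h0 => by
      rw [h0] at hh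
      exact hw3 hh.2
    simp [incr, runs_assign, Expr.inBounds, Expr.eval, Expr.cost, Test.cost, maxLetter]
    omega
  rintro s₁ T₁ hF₁ ht1 hh hT₁
  have n₁ : s₁.reg .n = w.length + 1 := (hF₁.1 .n rfl).trans hI.n
  have k₁ : s₁.reg .k = k := (hF₁.1 .k rfl).trans hI.k
  have i₁ : s₁.arr .inp = letter (σ :: w) := (hF₁.2 .inp rfl).trans hI.inp
  simp only [Test.holds, Expr.eval, maxLetter, i₁, k₁, n₁] at hh
  simp [Test.cost, Expr.cost, maxLetter] at hT₁
  have t₁ : s₁.reg .t = t := by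
    by_contra h0
    exact hh ⟨by omega, hw1 _ (by omega)⟩
  rw [block, runs_seq]
  simp only [runs_assign, Expr.inBounds, Expr.eval, Expr.cost, true_and, n₁, t₁, and_true]
  rw [show w.length + 1 - 1 - t = w'.length by omega]
  refine ⟨by omega, ?_⟩
  rw [block, runs_seq]
  simp only [runs_assign, Expr.inBounds, Expr.eval, Expr.cost, true_and]
  refine ⟨Nat.zero_le _, ?_⟩
  rw [block, runs_seq]
  refine runs_loop
    (fun s' => s'.reg .j ≤ w'.length ∧ ∀ e < s'.reg .j, s'.arr .x e = letter w' e)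
    (fun s' => 40 * (w'.length - s'.reg .j)) ?_ ?_ ?_ ?_
  · simp
  · intro s' _ _
    simp [Test.inBounds, Expr.inBounds]
  · rintro s' hF ⟨h1, h2⟩ hh
    have e1 : s'.reg .len = w'.length := hF.1 .len rfl
    have e2 : s'.arr .inp = letter (σ :: w) := (hF.2 .inp rfl).trans i₁
    have e3 : s'.reg .t = t := (hF.1 .t rfl).trans t₁
    simp only [Test.holds, Expr.eval, e1] at hh
    simp [block, incr, runs_seq, runs_assign, runs_skip, runs_store,
      Expr.inBounds, Expr.eval, Expr.cost, Test.cost, e2, e3]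
    refine ⟨by omega, by omega, hlet _, by omega, ⟨by omega, fun e he => ?_⟩, by omega⟩
    rcases he.lt_or_eq with he | rfl
    · rw [Function.update_of_ne he.ne, h2 e he]
    · rw [Function.update_self, hw2]
  rintro s₂ T₂ hF₂ ⟨hj1, hj2⟩ hh₂ hT₂
  have l₂ : s₂.reg .len = w'.length := hF₂.1 .len rfl
  simp only [Test.holds, Expr.eval, l₂] at hh₂
  simp [Test.cost, Expr.cost] at hT₂
  rw [show s₂.reg .j = w'.length by omega] at hj2
  rw [block, runs_seq]
  refine (runs_duval (f := s₂.arr .x) (len := w'.length) rfl l₂ (by omega) (by omega)).mono ?_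
  rintro s₃ T₃ hF₃ ⟨fs, hinv, hm, hT₃⟩
  have l₃ : s₃.reg .len = w'.length := (hF₃.1 .len rfl).trans l₂
  have x₃ : s₃.arr .x = s₂.arr .x := hF₃.2 .x rfl
  -- The array `x` agrees with w' only on the first |w'| cells, hence the two changes of function.
  have hq : LyndonPeriod (letter w') w'.length (s₃.arr .fac 1) :=
    (hinv.first hpos (hpre.congr fun i hi => (hj2 i hi).symm)).congr hj2
  generalize hqdef : s₃.arr .fac 1 = q at *
  have hqpos := hq.pos
  have hqle := hq.1
  rw [block, runs_seq]
  simp only [runs_assign, Expr.inBounds, Expr.eval, Expr.cost, true_and, l₃]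
  refine ⟨by omega, ?_⟩
  rw [block, runs_seq]
  -- Repeated subtraction computes the remainder. Each subtraction removes q ≥ 1, so a potential
  -- proportional to r pays for it.
  refine runs_loop
    (fun s' => s'.reg .r ≤ w'.length ∧ s'.reg .r % q = w'.length % q)
    (fun s' => 20 * s'.reg .r) ?_ ?_ ?_ ?_
  · simp
  · intro s' _ _
    simp [Test.inBounds, Expr.inBounds, Expr.eval]
    omega
  · rintro s' hF ⟨h1, h2⟩ hh
    have e1 : s'.arr .fac 1 = q := by rw [hF.2 .fac rfl]; exact hqdef
    simp only [Test.holds, Expr.eval, e1] at hh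
    simp [runs_assign, Expr.inBounds, Expr.eval, Expr.cost, Test.cost, e1]
    exact ⟨by omega, by omega, ⟨by omega, by rw [← Nat.mod_eq_sub_mod hh, h2]⟩, by omega⟩
  rintro s₄ T₄ hF₄ ⟨hr1, hr2⟩ hh₄ hT₄
  have e1 : s₄.arr .fac 1 = q := by rw [hF₄.2 .fac rfl]; exact hqdef
  have x₄ : s₄.arr .x = s₂.arr .x := (hF₄.2 .x rfl).trans x₃
  simp only [Test.holds, Expr.eval, e1] at hh₄
  simp [Test.cost, Expr.cost] at hT₄
  rw [Nat.mod_eq_of_lt (by omega)] at hr2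
  have hx : s₄.arr .x (s₄.reg .r) = letter w' (w'.length % q) := by
    rw [x₄, hj2 _ (by omega), hr2]
  simp [block, runs_seq, runs_assign, runs_skip, Expr.inBounds, Expr.eval, Expr.cost, hx]
  refine ⟨by omega, ?_, ⟨q, hq, rfl⟩, by omega⟩
  rw [← hw2]
  exact hlet _

/-! ### The values of `next` -/

section Next
variable {k σ : ℕ} {w : List ℕ}

theorem next_of_head (hσ : σ < k - 1) (h : Head k (w ++ [σ])) : next k (σ :: w) = w ++ [σ + 1] := by
  rw [next, if_pos ⟨hσ.ne, h⟩]

theorem next_of_isLeast {c : ℕ} (hσ : σ = k - 1) (h : IsLeast (headLetters k w) c) :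
    next k (σ :: w) = w ++ [c] := by
  rw [next, if_neg fun h' => h'.1 hσ, if_pos ⟨hσ, ⟨c, h.1⟩⟩,
    h.unique ⟨Nat.sInf_mem ⟨c, h.1⟩, fun _ hb => Nat.sInf_le hb⟩]

theorem next_of_not (hσk : σ < k) (h : ¬ (σ < k - 1 ∧ Head k (w ++ [σ])))
    (h' : σ = k - 1 → ¬ (headLetters k w).Nonempty) : next k (σ :: w) = w ++ [σ] := by
  rw [next, if_neg fun h0 => h ⟨lt_of_le_of_ne (by omega) h0.1, h0.2⟩,
    if_neg fun h0 => h' h0.1 h0.2]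

/-- Here w' is empty, so every letter of [k-1] passes the head test and the minimum is 0. -/
theorem next_replicate (hk : 2 ≤ k) (n : ℕ) :
    next k (List.replicate (n + 1) (k - 1)) = List.replicate n (k - 1) ++ [0] :=
  next_of_isLeast rfl
    ⟨⟨by omega, head_replicate_append_singleton (by omega)⟩, fun _ _ => Nat.zero_le _⟩

theorem length_next : (next k (σ :: w)).length = w.length + 1 := by
  rw [next]
  split_ifs <;> simp

/-- With σ = k-1, an empty w' would make the whole input (k-1)^n; so w' has a first letter, as the
fractional power requires. -/
theorem exists_decomposition (hσ : σ = k - 1)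
    (hne : σ :: w ≠ List.replicate (w.length + 1) (k - 1)) :
    ∃ t w', w = List.replicate t (k - 1) ++ w' ∧ w' ≠ [] ∧ w'.head? ≠ some (k - 1) := by
  obtain ⟨t, w', hw, hhd⟩ := exists_eq_replicate_append (k - 1) w
  refine ⟨t, w', hw, ?_, hhd⟩
  rintro rfl
  apply hne
  rw [List.append_nil] at hw
  rw [hw, hσ, List.length_replicate, List.replicate_succ]

theorem IsFractionalPower.exists_period {x u v : List ℕ} {m c : ℕ}
    (h : IsFractionalPower x u m v) (hc : x[v.length]? = some c) :
    ∃ q, LyndonPeriod (letter x) x.length q ∧ c = letter x (x.length % q) := by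
  obtain ⟨h1, h2⟩ := h.lyndonPeriod
  refine ⟨u.length, h1, ?_⟩
  rw [← h2]
  simp [letter, hc]

theorem LyndonPeriod.exists_isFractionalPower {x : List ℕ} {q : ℕ}
    (h : LyndonPeriod (letter x) x.length q) :
    ∃ u m v, IsFractionalPower x u m v ∧ x[v.length]? = some (letter x (x.length % q)) := by
  refine ⟨_, _, _, h.isFractionalPower, ?_⟩
  have h1 := Nat.mod_lt x.length h.pos
  have h2 := h.1
  have hlt : x.length % q < x.length := by omega
  rw [List.length_take_of_le hlt.le, List.getElem?_eq_getElem hlt, letter_eq_getElem hlt]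

theorem Returns.eq_next (hk : 2 ≤ k) (hσk : σ < k) (hwk : ∀ a ∈ w, a < k) {r : List ℕ}
    (h : Returns k σ w r) : r = next k (σ :: w) := by
  cases h with
  | incr h => exact (next_of_head h.1 h.2).symm
  | allMax _ h => rw [h, next_replicate hk]
  | minFirst t w' u m v c h1 h2 h3 h4 h5 h6 h7 h8 =>
    subst h4
    have hwk' : ∀ a ∈ w', a < k := fun a ha => hwk a (List.mem_append_right _ ha)
    obtain ⟨q, hq, rfl⟩ := h6.exists_period h7
    exact (next_of_isLeast h3.1 ((isLeast_headLetters h5 hwk' hq ⟨k - 2, by omega, h3.2⟩).1 h8)).symm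
  | minSecond t w' u m v c h1 h2 h3 h4 h5 h6 h7 h8 =>
    subst h4
    have hwk' : ∀ a ∈ w', a < k := fun a ha => hwk a (List.mem_append_right _ ha)
    obtain ⟨q, hq, rfl⟩ := h6.exists_period h7
    exact (next_of_isLeast h3.1 ((isLeast_headLetters h5 hwk' hq ⟨k - 2, by omega, h3.2⟩).2 h8)).symm
  | rot h1 h2 h3 =>
    refine (next_of_not hσk h1 fun hσ hne => ?_).symm
    obtain ⟨t, w', rfl, hw', hhd⟩ := exists_decomposition hσ h2
    exact h3 ⟨hσ, (headLetters_nonempty_iff hk hw' hhd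
      fun a ha => hwk a (List.mem_append_right _ ha)).1 hne⟩

/-- The only possible obstruction is the decomposition in step 3; the test on k-2 that leads there
makes w' a prenecklace, so the decomposition exists. -/
theorem exists_returns (hk : 2 ≤ k) : ∃ r, Returns k σ w r := by
  by_cases h1 : σ < k - 1 ∧ Head k (w ++ [σ])
  · exact ⟨_, .incr h1⟩
  by_cases h2 : σ :: w = List.replicate (w.length + 1) (k - 1)
  · exact ⟨_, .allMax h1 h2⟩
  by_cases h3 : σ = k - 1 ∧ Head k (w ++ [k - 2])
  · obtain ⟨t, w', hw, hw', hhd⟩ := exists_decomposition h3.1 h2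
    have hh := h3.2
    rw [hw] at hh
    obtain ⟨q, hq⟩ := (hh.prenecklace (by omega) hhd).exists_lyndonPeriod
      (List.length_pos_iff.2 hw')
    obtain ⟨u, m, v, h4, h5⟩ := hq.exists_isFractionalPower
    by_cases h6 : Head k (w ++ [letter w' (w'.length % q)])
    · exact ⟨_, .minFirst t w' u m v _ h1 h2 h3 hw hhd h4 h5 h6⟩
    · exact ⟨_, .minSecond t w' u m v _ h1 h2 h3 hw hhd h4 h5 h6⟩
  · exact ⟨_, .rot h1 h2 h3⟩

theorem returns_iff (hk : 2 ≤ k) (hσk : σ < k) (hwk : ∀ a ∈ w, a < k) (r : List ℕ) :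
    Returns k σ w r ↔ r = next k (σ :: w) := by
  refine ⟨Returns.eq_next hk hσk hwk, ?_⟩
  rintro rfl
  obtain ⟨r, hr⟩ := exists_returns (σ := σ) (w := w) hk
  rwa [← hr.eq_next hk hσk hwk]

end Next

/-! ### The whole program -/

section Program
variable {M W k σ : ℕ} {w : List ℕ} {s : State}

theorem HasInput.firstLetter (hI : HasInput M W k σ w s) :
    firstLetter.inBounds M s ∧ firstLetter.eval s = σ := by
  have := hI.length_lt_M
  rw [PreferMin.firstLetter]
  simp only [Expr.inBounds, Expr.eval, hI.inp, letter_cons_zero, true_and, and_true]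
  omega

theorem HasInput.eval_maxLetter (hI : HasInput M W k σ w s) : maxLetter.eval s = k - 1 := by
  simp only [maxLetter, Expr.eval, hI.k]

theorem HasInput.letter_append_le (hI : HasInput M W k σ w s) {ρ : ℕ} (hρ : ρ ≤ W) (i : ℕ) :
    letter (w ++ [ρ]) i ≤ W := by
  rcases lt_trichotomy i w.length with h | rfl | h
  · rw [letter_append_left h, ← letter_cons_succ σ]
    exact hI.letter_le _
  · rwa [letter_append_length]
  · rw [letter, List.getD_eq_default _ _ (by simpa using h)]
    exact Nat.zero_le _

theorem HasInput.setReg (hI : HasInput M W k σ w s) {v : Reg} (hn : v ≠ .n) (hk : v ≠ .k)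
    (y : ℕ) : HasInput M W k σ w (s.setReg v y) :=
  ⟨by simpa [hn.symm] using hI.n, by simpa [hk.symm] using hI.k, hI.inp, hI.letter_le,
    hI.length_lt_M, hI.length_le_W⟩

/-- The conjunction of a test and the head predicate. -/
theorem runs_cond_headTest {b : Test} {e : Expr} {ρ : ℕ} (hI : HasInput M W k σ w s)
    (hh : s.reg .h = 0) (hb : b.inBounds M s)
    (he : ∀ s', Frame (writeShift .buf e) s s' → e.inBounds M s' ∧ e.eval s' = ρ)
    (hρk : b.holds s → ρ < k - 1) (hρ : ρ ≤ W) :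
    Runs M W (.cond b (block [writeShift .buf e, headTest]) .skip) s fun s' T =>
      HasInput M W k σ w s' ∧ (s'.reg .h = 1 ↔ b.holds s ∧ Head k (w ++ [ρ])) ∧
        T ≤ 430 * w.length + e.cost + b.cost + 740 := by
  rw [runs_cond]
  refine ⟨hb, fun hbs => ?_, fun hbs => ?_⟩
  · rw [block, runs_seq]
    refine (runs_writeShift hI (by decide) hρ he).mono ?_
    rintro s₁ T₁ hF₁ ⟨hbuf, hT₁⟩
    have hI₁ := hI.of_frame hF₁ rfl rfl rfl
    rw [block, runs_seq]
    refine (runs_headTest hI₁.n hI₁.k hI₁.length_lt_M hI₁.length_le_W (hρk hbs) hbuf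
      (hI.letter_append_le hρ)).mono ?_
    rintro s₂ T₂ hF₂ ⟨hh, hT₂⟩
    rw [block, runs_skip]
    exact ⟨hI₁.of_frame hF₂ rfl rfl rfl, by rw [hh]; simp [hbs], by omega⟩
  · rw [runs_skip]
    exact ⟨hI, by simp [hh, hbs], by omega⟩

/-- The test whether all letters of the input are equal to `k - 1`. -/
theorem runs_allMax (hI : HasInput M W k σ w s) (ha : s.reg .a = 1) (hj : s.reg .j = 0) :
    Runs M W (.loop (.lt (.reg .j) (.reg .n)) (block [
        .cond (.eq (.read .inp (.reg .j)) maxLetter) .skip (.assign .a (.lit 0)),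
        incr .j])) s fun s' T =>
      (s'.reg .a = 1 ↔ σ :: w = List.replicate (w.length + 1) (k - 1)) ∧
        T ≤ 40 * w.length + 60 := by
  have hM := hI.length_lt_M
  have hW := hI.length_le_W
  refine runs_loop
    (fun s' => s'.reg .j ≤ w.length + 1 ∧
      (s'.reg .a = 1 ↔ ∀ e < s'.reg .j, letter (σ :: w) e = k - 1))
    (fun s' => 40 * (w.length + 1 - s'.reg .j)) ?_ ?_ ?_ ?_
  · simp [ha, hj]
  · intro s' _ _
    simp [Test.inBounds, Expr.inBounds]
  · rintro s' hF ⟨h1, h2⟩ hh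
    have hI' := hI.of_frame hF rfl rfl rfl
    simp only [Test.holds, Expr.eval, hI'.n] at hh
    simp [block, incr, runs_seq, runs_assign, runs_skip, runs_cond, Test.inBounds, Test.holds,
      Expr.inBounds, Expr.eval, Expr.cost, Test.cost, hI'.inp, hI'.k, maxLetter]
    refine ⟨by omega, fun hx => ⟨by omega, ⟨by omega, ?_⟩, by omega⟩,
      fun hx => ⟨by omega, ⟨by omega, s'.reg .j, by omega, hx⟩, by omega⟩⟩
    rw [h2]
    refine ⟨fun h e he => ?_, fun h e he => h e (by omega)⟩
    rcases he.lt_or_eq with he | rfl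
    · exact h e he
    · exact hx
  · rintro s' T hF ⟨h1, h2⟩ hh hT
    have hI' := hI.of_frame hF rfl rfl rfl
    simp only [Test.holds, Expr.eval, hI'.n] at hh
    simp [Test.cost, Expr.cost, hj] at hT
    rw [show s'.reg .j = w.length + 1 by omega] at h2
    refine ⟨h2.trans ⟨fun h => ?_, fun h e he => ?_⟩, by omega⟩
    · refine ext_letter (by simp) fun i hi => ?_
      rw [List.length_cons] at hi
      rw [h i hi, letter_replicate hi]
    · rw [h, letter_replicate he]

/-- The program computes `next` in linear time. -/
theorem runs_algorithm (hk : 2 ≤ k) (hσk : σ < k) (hwk : ∀ a ∈ w, a < k)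
    (hI : HasInput M W k σ w s) (hW : k ≤ W) :
    Runs M W algorithm s fun s' T =>
      (∀ i ≤ w.length, s'.arr .out i = letter (next k (σ :: w)) i) ∧
        T ≤ 2000 * w.length + 4000 := by
  rw [algorithm, block, runs_seq]
  simp only [runs_assign, Expr.inBounds, Expr.eval, Expr.cost, true_and]
  refine ⟨Nat.zero_le _, ?_⟩
  have hI₀ : HasInput M W k σ w (s.setReg .h 0) := hI.setReg (by decide) (by decide) 0
  rw [block, runs_seq]
  refine (runs_cond_headTest (b := .lt firstLetter maxLetter) (ρ := σ) hI₀ (by simp)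
    ⟨hI₀.firstLetter.1, by simp [maxLetter, Expr.inBounds]⟩
    (fun s' hF => (hI₀.of_frame hF rfl rfl rfl).firstLetter)
    (fun h => by
      rwa [Test.holds, hI₀.firstLetter.2, hI₀.eval_maxLetter] at h) (by omega)).mono ?_
  rintro s₁ T₁ - ⟨hI₁, hh₁, hT₁⟩
  rw [Test.holds, hI₀.firstLetter.2, hI₀.eval_maxLetter] at hh₁
  simp only [firstLetter, maxLetter, Expr.cost, Test.cost] at hT₁
  rw [block, runs_seq, runs_cond]
  simp only [Test.inBounds, Expr.inBounds, Test.holds, Expr.eval, Test.cost, Expr.cost, true_and,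
    block, runs_skip]
  refine ⟨fun h1 => ?_, fun h1 => ?_⟩
  · have hh := hh₁.1 h1
    refine (runs_writeShift (y := σ + 1) hI₁ (by decide) (by omega) fun s' hF => ?_).mono ?_
    · have := (hI₁.of_frame hF rfl rfl rfl).firstLetter
      simpa [Expr.inBounds, Expr.eval] using this
    · rintro s₂ T₂ - ⟨hout, hT₂⟩
      rw [next_of_head hh.1 hh.2]
      simp only [firstLetter, Expr.cost] at hT₂
      exact ⟨hout, by omega⟩
  rw [hh₁] at h1
  simp only [runs_seq, runs_assign, Expr.inBounds, Expr.eval, Expr.cost, true_and]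
  refine ⟨by omega, Nat.zero_le _, ?_⟩
  have hI₁' : HasInput M W k σ w ((s₁.setReg .a 1).setReg .j 0) :=
    (hI₁.setReg (by decide) (by decide) _).setReg (by decide) (by decide) _
  refine (runs_allMax hI₁' (by simp) (by simp)).mono ?_
  rintro s₂ T₂ hF₂ ⟨ha, hT₂⟩
  have hI₂ := hI₁'.of_frame hF₂ rfl rfl rfl
  rw [runs_cond]
  simp only [Test.inBounds, Expr.inBounds, Test.holds, Expr.eval, Test.cost, Expr.cost, true_and,
    runs_skip]
  refine ⟨fun h2 => ?_, fun h2 => ?_⟩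
  · refine (runs_writeShift (y := 0) hI₂ (by decide) (by omega) fun s' hF => ?_).mono ?_
    · simp [Expr.inBounds, Expr.eval]
    · rintro s₃ T₃ - ⟨hout, hT₃⟩
      have hmax := ha.1 h2
      have hw : w = List.replicate w.length (k - 1) := (List.cons.inj hmax).2
      simp only [Expr.cost] at hT₃
      rw [hmax, next_replicate hk, ← hw]
      exact ⟨hout, by omega⟩
  rw [ha] at h2
  rw [runs_seq]
  simp only [runs_assign, Expr.inBounds, Expr.eval, Expr.cost, true_and]
  refine ⟨Nat.zero_le _, ?_⟩
  have hI₂' : HasInput M W k σ w (s₂.setReg .h 0) := hI₂.setReg (by decide) (by decide) 0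
  rw [runs_seq]
  refine (runs_cond_headTest (b := .eq firstLetter maxLetter) (ρ := k - 2) hI₂' (by simp)
    ⟨hI₂'.firstLetter.1, by simp [maxLetter, Expr.inBounds]⟩
    (fun s' hF => by
      have := (hI₂'.of_frame hF rfl rfl rfl).k
      simp [Expr.inBounds, Expr.eval, this])
    (fun _ => by omega) (by omega)).mono ?_
  rintro s₃ T₃ - ⟨hI₃, hh₃, hT₃⟩
  rw [Test.holds, hI₂'.firstLetter.2, hI₂'.eval_maxLetter] at hh₃
  simp only [firstLetter, maxLetter, Expr.cost, Test.cost] at hT₃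
  rw [runs_seq, runs_cond]
  simp only [Test.inBounds, Expr.inBounds, Test.holds, Expr.eval, Test.cost, Expr.cost, true_and,
    runs_skip]
  refine ⟨fun h3 => ?_, fun h3 => ?_⟩
  · obtain ⟨hσ, hhead⟩ := hh₃.1 h3
    obtain ⟨t, w', hw, hw', hhd⟩ := exists_decomposition hσ h2
    have hwk' : ∀ a ∈ w', a < k := fun a ha => hwk a (hw ▸ List.mem_append_right _ ha)
    have hne : (headLetters k w).Nonempty := ⟨k - 2, by omega, hhead⟩
    rw [runs_seq]
    refine (runs_findLetter hI₃ hw hw' hhd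
      (Head.prenecklace (t := t) (ρ := k - 2) (by omega) hhd (by rwa [← hw]))).mono ?_
    rintro s₄ T₄ hF₄ ⟨⟨q, hq, hsig⟩, hT₄⟩
    have hI₄ := hI₃.of_frame hF₄ rfl rfl rfl
    have hleast := isLeast_headLetters (t := t) hhd hwk' hq (by rwa [← hw])
    rw [← hw] at hleast
    generalize letter w' (w'.length % q) = c at *
    -- The head test is verified only for letters of [k-1]. Here σ' qualifies because it, or its
    -- successor, is a member of S.
    have hck : c < k - 1 := by
      by_cases hc : Head k (w ++ [c])
      · exact (hleast.1 hc).1.1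
      · have := (hleast.2 hc).1.1
        omega
    rw [runs_seq]
    refine (runs_writeShift (y := c) hI₄ (by decide) (by omega) fun s' hF => ?_).mono ?_
    · simp [Expr.inBounds, Expr.eval, hF.1 .sig rfl, hsig]
    rintro s₅ T₅ hF₅ ⟨hbuf, hT₅⟩
    have hI₅ := hI₄.of_frame hF₅ rfl rfl rfl
    have hsig₅ : s₅.reg .sig = c := (hF₅.1 .sig rfl).trans hsig
    rw [runs_seq]
    refine (runs_headTest hI₅.n hI₅.k hI₅.length_lt_M hI₅.length_le_W hck hbuf
      (hI₅.letter_append_le (by omega))).mono ?_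
    rintro s₆ T₆ hF₆ ⟨hh₆, hT₆⟩
    have hI₆ := hI₅.of_frame hF₆ rfl rfl rfl
    have hsig₆ : s₆.reg .sig = c := (hF₆.1 .sig rfl).trans hsig₅
    simp only [Expr.cost] at hT₅
    rw [runs_seq, runs_cond]
    simp only [Test.inBounds, Expr.inBounds, Test.holds, Expr.eval, Test.cost, Expr.cost, true_and,
      runs_skip]
    refine ⟨fun h4 => ?_, fun h4 => ?_⟩
    · refine (runs_writeShift (y := c) hI₆ (by decide) (by omega) fun s' hF => ?_).mono ?_
      · simp [Expr.inBounds, Expr.eval, hF.1 .sig rfl, hsig₆]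
      · rintro s₇ T₇ - ⟨hout, hT₇⟩
        rw [next_of_isLeast hσ (hleast.1 (hh₆.1 h4))]
        simp only [Expr.cost] at hT₇
        exact ⟨hout, by omega⟩
    · refine (runs_writeShift (y := c + 1) hI₆ (by decide) (by omega) fun s' hF => ?_).mono ?_
      · simp [Expr.inBounds, Expr.eval, hF.1 .sig rfl, hsig₆]
      · rintro s₇ T₇ - ⟨hout, hT₇⟩
        rw [next_of_isLeast hσ (hleast.2 fun h => h4 (hh₆.2 h))]
        simp only [Expr.cost] at hT₇
        exact ⟨hout, by omega⟩
  · rw [hh₃] at h3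
    refine (runs_writeShift (y := σ) hI₃ (by decide) (by omega)
      fun s' hF => (hI₃.of_frame hF rfl rfl rfl).firstLetter).mono ?_
    rintro s₄ T₄ - ⟨hout, hT₄⟩
    rw [← Returns.eq_next hk hσk hwk (.rot h1 h2 h3)]
    simp only [firstLetter, Expr.cost] at hT₄
    exact ⟨hout, by omega⟩

end Program

end PreferMin

/-- There is an absolute constant `C` such that for all `n, k ≥ 2` and every input `σ w ∈ [k]^n`:
the pseudocode returns `next (σ w)` and nothing else; the head predicate, on the words on which it
is evaluated (those that do not end in `k-1`), is decided by the Chen–Fox–Lyndon factorization of a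
rotation; in the second case `min S ∈ {σ', σ'+1}`; and the program computes `next (σ w)` in time at
most `C n`, with at most `C n` memory cells, each of which holds a number of size at most `n + k`. -/
theorem theorem5 :
    ∃ C : ℕ, ∀ (n k : ℕ), 2 ≤ n → 2 ≤ k →
      ∀ (σ : ℕ) (w : List ℕ), σ < k → (∀ a ∈ w, a < k) → w.length + 1 = n →
        (∀ r : List ℕ, PreferMin.Returns k σ w r ↔ r = PreferMin.next k (σ :: w)) ∧
        (∀ ρ < k - 1, ∀ i : ℕ,
          IsGreatest {i : ℕ | List.replicate i (k - 1) <+: w ++ [ρ]} i →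
            (∃ fs, PreferMin.IsCFL ((w ++ [ρ]).rotate i) fs) ∧
            ∀ fs, PreferMin.IsCFL ((w ++ [ρ]).rotate i) fs →
              (PreferMin.Head k (w ++ [ρ]) ↔ fs.head? = fs.getLast?)) ∧
        (σ = k - 1 → (PreferMin.headLetters k w).Nonempty →
          σ :: w ≠ List.replicate n (k - 1) →
          ∃ (t : ℕ) (w' u : List ℕ) (m : ℕ) (v : List ℕ) (σ' : ℕ),
            w = List.replicate t (k - 1) ++ w' ∧ w'.head? ≠ some (k - 1) ∧
            PreferMin.IsFractionalPower w' u m v ∧ w'[v.length]? = some σ' ∧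
            (IsLeast (PreferMin.headLetters k w) σ' ∨
              IsLeast (PreferMin.headLetters k w) (σ' + 1))) ∧
        ∃ (M T : ℕ) (s : PreferMin.State),
          PreferMin.memoryCells M ≤ C * n ∧ T ≤ C * n ∧
          PreferMin.Exec M (n + k) PreferMin.algorithm
            (PreferMin.initState n k (σ :: w)) s T ∧
          PreferMin.output n s = PreferMin.next k (σ :: w) := by
  -- The time bound 2000|w| + 4000 is at most 4000n, and the 13 registers and 5 arrays of n + 1
  -- cells need far less.
  refine ⟨4000, ?_⟩
  rintro n k hn hk σ w hσk hwk rfl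
  refine ⟨PreferMin.returns_iff hk hσk hwk, fun ρ hρ i hi => ⟨PreferMin.exists_isCFL _,
    fun fs hfs => ?_⟩, fun hσ hne hmax => ?_, ?_⟩
  · rw [PreferMin.head_iff_isExpandedLyndon_rotate hρ hi, hfs.isExpandedLyndon_iff (by simp)]
  · obtain ⟨t, w', rfl, hw', hhd⟩ := PreferMin.exists_decomposition hσ hmax
    have hwk' : ∀ a ∈ w', a < k := fun a ha => hwk a (List.mem_append_right _ ha)
    obtain ⟨ρ, hρ⟩ := id hne
    obtain ⟨q, hq⟩ := (PreferMin.Head.prenecklace hρ.1 hhd hρ.2).exists_lyndonPeriod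
      (List.length_pos_iff.2 hw')
    obtain ⟨u, m, v, h1, h2⟩ := hq.exists_isFractionalPower
    have hleast := PreferMin.isLeast_headLetters hhd hwk' hq hne
    refine ⟨t, w', u, m, v, _, rfl, hhd, h1, h2, ?_⟩
    by_cases h : PreferMin.Head k
        (List.replicate t (k - 1) ++ w' ++ [PreferMin.letter w' (w'.length % q)])
    · exact Or.inl (hleast.1 h)
    · exact Or.inr (hleast.2 h)
  -- Arrays have n + 1 cells because `fac` holds the start of the first factor and up to n end
  -- points.
  · have hI : PreferMin.HasInput (w.length + 2) (w.length + 1 + k) k σ w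
        (PreferMin.initState (w.length + 1) k (σ :: w)) := by
      refine ⟨rfl, rfl, rfl, fun i => ?_, by omega, by omega⟩
      rcases Nat.lt_or_ge i (σ :: w).length with h | h
      · have := PreferMin.letter_lt (K := k) (l := σ :: w)
          (fun a ha => (List.mem_cons.1 ha).elim (fun h => h ▸ hσk) (hwk a)) h
        omega
      · rw [PreferMin.letter, List.getD_eq_default _ _ h]
        exact Nat.zero_le _
    obtain ⟨s, T, hexec, hout, hT⟩ :=
      PreferMin.runs_algorithm hk hσk hwk hI (by omega)
    refine ⟨w.length + 2, T, s, ?_, by omega, hexec, ?_⟩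
    · have h1 : Fintype.card PreferMin.Reg = 13 := rfl
      have h2 : Fintype.card PreferMin.Arr = 5 := rfl
      rw [PreferMin.memoryCells, h1, h2]
      omega
    · refine PreferMin.ext_letter ?_ fun i hi => ?_
      · rw [PreferMin.length_next]
        simp [PreferMin.output]
      · have hi' : i < w.length + 1 := by simpa [PreferMin.output] using hi
        rw [PreferMin.output, PreferMin.letter_map_range _ hi', hout i (by omega)]
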